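/- For a numerical semigroup $S$ (a subset of $\mathbb{Z}_{\ge 0}$ that contains $0$, is closed under addition and has finite complement), let $\mathsf e(S)$ be its embedding dimension (the number of minimal generators), $\mathsf m(S)$ its multiplicity (the smallest nonzero element), and $\eta(S)$ the cardinality of any minimal presentation of $S$, that is, of a minimal set of pairs of factorizations that generates, as a congruence, the kernel of the homomorphism $\mathbb{Z}_{\ge 0}^{\mathsf e(S)} \to S$, $z \mapsto \sum_i z_i n_i$, where $n_1, n_2, \ldots$ are the minimal generators of $S$. Let $e \ge 4$ and $r \ge 0$ be integers. (1) For every integer $s$ with $0 \le s \le \min(e-2, r)$ there exists a numerical semigroup $S$ with $\mathsf e(S) = e$, $\mathsf m(S) = e + r$ and $\eta(S) = \binom{e}{2} - s$. (2) If $r \le e - 1$ and $(e, r) \ne (4, 3)$, then the lower bound $\eta(S) \ge \binom{e}{2} - r$, valid for all numerical semigroups $S$ with $\mathsf e(S) = e$ and $\mathsf m(S) = e + r$, is sharp: $\binom{e}{2} - r$ is the minimum of $\eta(S)$ over all such $S$. -/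

import Mathlib

namespace NumSgp

/-- A numerical semigroup: an additive submonoid of `ℕ` whose complement is finite. -/
def IsNumericalSemigroup (S : AddSubmonoid ℕ) : Prop :=
  ((S : Set ℕ)ᶜ).Finite

/-- The atoms of `S`, i.e. the nonzero elements of `S` that are not a sum of two nonzero
elements of `S`. They form the unique minimal generating set of `S`; see `closure_atoms` and
`atoms_subset_of_closure_eq`. -/
def atoms (S : AddSubmonoid ℕ) : Set ℕ :=
  {n | n ∈ S ∧ n ≠ 0 ∧ ∀ a ∈ S, ∀ b ∈ S, a + b = n → a = 0 ∨ b = 0}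

/-- The atoms generate `S`. -/
theorem closure_atoms (S : AddSubmonoid ℕ) : AddSubmonoid.closure (atoms S) = S := by
  apply le_antisymm
  · rw [AddSubmonoid.closure_le]
    exact fun n hn => hn.1
  · intro n
    induction n using Nat.strong_induction_on with
    | _ n ih =>
      intro hn
      by_cases h0 : n = 0
      · subst h0
        exact zero_mem _
      by_cases hat : n ∈ atoms S
      · exact AddSubmonoid.subset_closure hat
      · have : ∃ a ∈ S, ∃ b ∈ S, a + b = n ∧ a ≠ 0 ∧ b ≠ 0 := by
          by_contra hcon
          push Not at hcon
          exact hat ⟨hn, h0, fun a ha b hb hab => or_iff_not_imp_left.2 (hcon a ha b hb hab)⟩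
        obtain ⟨a, ha, b, hb, hab, ha0, hb0⟩ := this
        rw [← hab]
        exact add_mem (ih a (by omega) ha) (ih b (by omega) hb)

/-- Every generating set of `S` contains the atoms. -/
theorem atoms_subset_of_closure_eq (S : AddSubmonoid ℕ) (G : Set ℕ)
    (hG : AddSubmonoid.closure G = S) : atoms S ⊆ G := by
  rintro n ⟨hn, h0, hirr⟩
  have key : ∀ x ∈ AddSubmonoid.closure G, x ∈ G ∨ x = 0 ∨
      ∃ a ∈ S, ∃ b ∈ S, a + b = x ∧ a ≠ 0 ∧ b ≠ 0 := by
    intro x hx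
    induction hx using AddSubmonoid.closure_induction with
    | mem x hx => exact Or.inl hx
    | zero => exact Or.inr (Or.inl rfl)
    | add x y hx hy ihx ihy =>
      by_cases hx0 : x = 0
      · simpa [hx0] using ihy
      by_cases hy0 : y = 0
      · simpa [hy0] using ihx
      exact Or.inr (Or.inr ⟨x, hG ▸ hx, y, hG ▸ hy, rfl, hx0, hy0⟩)
  rcases key n (hG ▸ hn) with h | h | ⟨a, ha, b, hb, hab, ha0, hb0⟩
  · exact h
  · exact absurd h h0
  · rcases hirr a ha b hb hab with h | h
    · exact absurd h ha0
    · exact absurd h hb0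

/-- The embedding dimension of `S`: the number of atoms. -/
noncomputable def embDim (S : AddSubmonoid ℕ) : ℕ :=
  (atoms S).ncard

/-- The multiplicity of `S`: its smallest nonzero element. -/
noncomputable def mult (S : AddSubmonoid ℕ) : ℕ :=
  sInf {n | n ∈ S ∧ n ≠ 0}

/-- Tuples of nonnegative integers indexed by the atoms of `S`. -/
abbrev Fact (S : AddSubmonoid ℕ) : Type :=
  atoms S →₀ ℕ

/-- The factorization homomorphism, sending `z` to `∑ a, z a * a`. -/
noncomputable def factHom (S : AddSubmonoid ℕ) : Fact S →+ ℕ :=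
  Finsupp.liftAddHom fun a => AddMonoidHom.mulRight (a : ℕ)

/-- `ρ` is a presentation of `S`: the smallest congruence on `Fact S` containing `ρ` is the
kernel of the factorization homomorphism. -/
def IsPresentation (S : AddSubmonoid ℕ) (ρ : Set (Fact S × Fact S)) : Prop :=
  addConGen (fun z w => (z, w) ∈ ρ) = AddCon.ker (factHom S)

/-- A minimal presentation: a presentation no proper subset of which is a presentation. -/
def IsMinimalPresentation (S : AddSubmonoid ℕ) (ρ : Set (Fact S × Fact S)) : Prop :=
  Minimal (IsPresentation S) ρ

/-- The cardinality `η(S)` of a minimal presentation of `S`. All minimal presentations of a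
numerical semigroup have the same finite cardinality, so the infimum over them is that common
value. -/
noncomputable def eta (S : AddSubmonoid ℕ) : ℕ∞ :=
  ⨅ (ρ : Set (Fact S × Fact S)) (_ : IsMinimalPresentation S ρ), ρ.encard

end NumSgp

/-!
Two factorizations of an element of `S` that are different and have an atom in common can be
shortened, so a presentation only has to connect, for each `n` in `S`, the components of the
factorizations of `n` under the relation of having an atom in common. A factorization that is a
component by itself is called isolated here; every sum of two atoms is isolated. Counting isolated
factorizations bounds the cardinality of every presentation from below
(`card_le_encard_add_card`), and connecting all factorizations to ones that contain a fixed atom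
gives presentations (`isPresentation_of_atom`).

For the lower bound (`le_eta`), let `m = e + r` be the multiplicity. There are `e.choose 2` sums of
two atoms different from `m`. The value `n` of such a sum has a further factorization, through `m`,
unless `n` is an Apéry element, and there are only `r` nonzero Apéry elements that are not atoms.

For the constructions, let `p` be any atom, and suppose that the elements of the Apéry set with
respect to `p` have unique factorizations. The minimal relations then correspond to the minimal
factorizations outside the Apéry set. In `IsApery` the Apéry set is given by a triangle-free graph
`G` on the atoms other than `p`, whose edges are the sums of two atoms inside the Apéry set, and by
a chain of multiples `j * y`, `j < t`, of one atom `y`. The minimal factorizations outside are the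
pairs of atoms that are not edges, with `2 * y` replaced by `t * y`. So there are
`e.choose 2` of them minus the number of edges, whatever `t` is. Three families suffice:
* a star with `s ≤ e - 3` edges and a disjoint chain of arbitrary length (`exists_star`);
* for `s = e - 2`, the gluing generated by `m` and the numbers `(m + 1) * v` with `v ≥ e - 1`,
  whose graph with respect to `p = (m + 1) * (e - 1)` is a star with centre `y = m`
  (`exists_glued`);
* for `s = r = e - 1 ≥ 4`, a bipartite graph with as many edges as vertices (`exists_bipartite`).
-/

/-! ### Factorizations and presentations -/

namespace NumSgp

open Finsupp

variable {S : AddSubmonoid ℕ}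

@[simp]
theorem factHom_single (a : atoms S) (n : ℕ) : factHom S (single a n) = n * a := by
  simp [factHom]

theorem factHom_mem (z : Fact S) : factHom S z ∈ S := by
  induction z using Finsupp.induction_linear with
  | zero => simp
  | add f g hf hg => rw [map_add]; exact add_mem hf hg
  | single a n => rw [factHom_single, ← smul_eq_mul]; exact nsmul_mem a.2.1 n

theorem exists_factHom_eq {n : ℕ} (hn : n ∈ S) : ∃ z : Fact S, factHom S z = n := by
  rw [← closure_atoms S] at hn
  induction hn using AddSubmonoid.closure_induction with
  | mem x hx => exact ⟨single ⟨x, hx⟩ 1, by simp⟩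
  | zero => exact ⟨0, map_zero _⟩
  | add x y _ _ hx hy =>
    obtain ⟨u, rfl⟩ := hx
    obtain ⟨v, rfl⟩ := hy
    exact ⟨u + v, map_add _ _ _⟩

theorem exists_single_add_of_pos {z : Fact S} {a : atoms S} (h : z a ≠ 0) :
    ∃ z', z = single a 1 + z' := by
  have : single a 1 ≤ z := by
    rw [Finsupp.single_le_iff]; omega
  exact exists_add_of_le this

theorem exists_apply_ne_zero {z : Fact S} (h : z ≠ 0) : ∃ a, z a ≠ 0 := by
  by_contra hc
  push Not at hc
  exact h (Finsupp.ext hc)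

theorem eq_zero_of_factHom_eq_zero {z : Fact S} (h : factHom S z = 0) : z = 0 := by
  by_contra hz
  obtain ⟨a, ha⟩ := exists_apply_ne_zero hz
  obtain ⟨z', rfl⟩ := exists_single_add_of_pos ha
  have := a.2.2.1
  rw [map_add, factHom_single] at h
  omega

/-- `z` is the only factorization of its value. -/
def IsUniqueFact (z : Fact S) : Prop :=
  ∀ w : Fact S, factHom S w = factHom S z → w = z

theorem isUniqueFact_zero : IsUniqueFact (0 : Fact S) := fun w hw =>
  eq_zero_of_factHom_eq_zero (by simpa using hw)

/-- If removing any atom that divides the value of `z` leaves a unique factorization, then `z` is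
itself unique. -/
theorem IsUniqueFact.of_atoms {z : Fact S} (hz : z ≠ 0)
    (h : ∀ a : atoms S, (∃ n ∈ S, (a : ℕ) + n = factHom S z) →
      ∃ z', z = single a 1 + z' ∧ IsUniqueFact z') : IsUniqueFact z := by
  intro w hw
  have hw0 : w ≠ 0 := by
    rintro rfl
    exact hz (eq_zero_of_factHom_eq_zero (by simpa using hw.symm))
  obtain ⟨a, ha⟩ := exists_apply_ne_zero hw0
  obtain ⟨w', rfl⟩ := exists_single_add_of_pos ha
  obtain ⟨z', rfl, hu⟩ := h a ⟨_, factHom_mem w', by rw [← hw]; simp⟩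
  rw [hu w' (by simpa using hw)]

theorem isUniqueFact_single (a : atoms S) : IsUniqueFact (single a 1) := by
  refine IsUniqueFact.of_atoms (by simp) fun c ⟨n, hn, hc⟩ => ⟨0, ?_, isUniqueFact_zero⟩
  have hc' : (c : ℕ) + n = a := by simpa using hc
  have := c.2.2.1
  rcases a.2.2.2 c c.2.1 n hn hc' with h | h
  · exact absurd h this
  · rw [add_zero, Subtype.ext (show (c : ℕ) = a by omega)]

/-- Any other factorization of the value of `z` has no atom in common with `z`. -/
def IsIsolated (z : Fact S) : Prop :=
  ∀ w : Fact S, factHom S w = factHom S z → w ≠ z → ∀ a, w a = 0 ∨ z a = 0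

/-- If removing any atom of `z` leaves a unique factorization, then `z` is isolated. -/
theorem IsIsolated.of_unique {z : Fact S}
    (h : ∀ a : atoms S, z a ≠ 0 → ∃ z', z = single a 1 + z' ∧ IsUniqueFact z') :
    IsIsolated z := by
  intro w hw hne a
  by_contra! hc
  obtain ⟨z', rfl, hu⟩ := h a hc.2
  obtain ⟨w', rfl⟩ := exists_single_add_of_pos hc.1
  exact hne (by rw [hu w' (by simpa using hw)])

theorem isIsolated_single_add_single (a b : atoms S) :
    IsIsolated (single a 1 + single b 1) := by
  refine IsIsolated.of_unique fun c hc => ?_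
  rcases eq_or_ne c a with rfl | hca
  · exact ⟨_, rfl, isUniqueFact_single b⟩
  rcases eq_or_ne c b with rfl | hcb
  · exact ⟨_, add_comm _ _, isUniqueFact_single a⟩
  · simp [hca.symm, hcb.symm] at hc

theorem isPresentation_rel_iff {ρ : Set (Fact S × Fact S)} (h : IsPresentation S ρ)
    (z w : Fact S) :
    addConGen (fun z w => (z, w) ∈ ρ) z w ↔ factHom S z = factHom S w := by
  rw [h]; rfl

/-- The extension by zero of a function on the index set of a family of factorizations. -/
noncomputable def extendZero {I : Type*} (ζ : I → Fact S) : (I → ℚ) →ₗ[ℚ] (Fact S → ℚ) :=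
  Function.ExtendByZero.linearMap ℚ ζ

/-- Each isolated factorization is a connected component of the graph of factorizations of its
value, so a presentation needs as many pairs as there are isolated factorizations, up to one
for each value all of whose factorizations are isolated (these values are represented by `T`).
Instead of counting edges of graphs, the proof counts dimensions: a function on the isolated
factorizations, extended by zero, that is invariant under `ρ` is constant on the factorizations
of each value, hence is determined by its restriction to `T`. -/
theorem card_le_encard_add_card {I : Type*} [Fintype I] (ζ : I → Fact S)
    (hinj : Function.Injective ζ) (hiso : ∀ i, IsIsolated (ζ i)) (T : Finset I)
    (hT : ∀ i, ∃ w, factHom S w = factHom S (ζ i) ∧ ((∀ j, w ≠ ζ j) ∨ ∃ j ∈ T, w = ζ j))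
    {ρ : Set (Fact S × Fact S)} (hρ : IsPresentation S ρ) :
    (Fintype.card I : ℕ∞) ≤ ρ.encard + T.card := by
  classical
  rcases ρ.finite_or_infinite with hfin | hinf
  swap
  · simp [hinf.encard_eq]
  have := hfin.fintype
  let ev : Fact S → (Fact S → ℚ) →ₗ[ℚ] ℚ := LinearMap.proj (φ := fun _ => ℚ)
  let L : (I → ℚ) →ₗ[ℚ] (ρ → ℚ) × (T → ℚ) :=
    LinearMap.prod
      (LinearMap.pi fun r : ρ => (ev r.1.1 - ev r.1.2) ∘ₗ extendZero ζ)
      (LinearMap.pi fun j : T => LinearMap.proj (φ := fun _ => ℚ) j.1)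
  have happ : ∀ (g : I → ℚ) (i : I), extendZero ζ g (ζ i) = g i := fun g i =>
    hinj.extend_apply _ _ _
  have happ0 : ∀ (g : I → ℚ) (w : Fact S), (∀ i, w ≠ ζ i) → extendZero ζ g w = 0 :=
    fun g w hw => Function.extend_apply' _ _ _ fun ⟨i, hi⟩ => hw i hi.symm
  have hL : Function.Injective L := by
    rw [injective_iff_map_eq_zero]
    intro g hg
    have h1 : ∀ r ∈ ρ, extendZero ζ g r.1 = extendZero ζ g r.2 := fun r hr => by
      have := congrFun (congrArg Prod.fst hg) ⟨r, hr⟩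
      simpa [L, ev, sub_eq_zero] using this
    have h2 : ∀ j ∈ T, g j = 0 := fun j hj => by
      simpa [L] using congrFun (congrArg Prod.snd hg) ⟨j, hj⟩
    let c : AddCon (Fact S) :=
      { r := fun z w => factHom S z = factHom S w ∧ extendZero ζ g z = extendZero ζ g w
        iseqv := ⟨fun _ => ⟨rfl, rfl⟩, fun h => ⟨h.1.symm, h.2.symm⟩,
          fun h h' => ⟨h.1.trans h'.1, h.2.trans h'.2⟩⟩
        add' := by
          have key : ∀ z w u : Fact S, factHom S z = factHom S w →
              extendZero ζ g z = extendZero ζ g w →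
              extendZero ζ g (z + u) = extendZero ζ g (w + u) := by
            intro z w u hv hzw
            rcases eq_or_ne u 0 with rfl | hu
            · simpa using hzw
            rcases eq_or_ne z w with rfl | hne
            · rfl
            obtain ⟨a, ha⟩ := exists_apply_ne_zero hu
            -- `z + u` and `w + u` share an atom of `u`, so neither is isolated.
            have hno : ∀ z w : Fact S, factHom S z = factHom S w → z ≠ w →
                ∀ i, z + u ≠ ζ i := by
              intro z w hv hne i hi
              rcases hiso i (w + u) (by rw [← hi, map_add, map_add, hv])
                (by rw [← hi]; exact fun h => hne (add_right_cancel h).symm) a with h | h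
              · simp at h; exact ha h.2
              · rw [← hi] at h; simp at h; exact ha h.2
            rw [happ0 g _ (hno z w hv hne), happ0 g _ (hno w z hv.symm hne.symm)]
          intro z w z' w' h h'
          refine ⟨by rw [map_add, map_add, h.1, h'.1], ?_⟩
          rw [key z w z' h.1 h.2, add_comm w, add_comm w, key z' w' w h'.1 h'.2] }
    have hle : addConGen (fun z w => (z, w) ∈ ρ) ≤ c := by
      rw [AddCon.addConGen_le]
      intro z w hzw
      refine ⟨?_, h1 (z, w) hzw⟩
      rw [← isPresentation_rel_iff hρ]
      exact AddConGen.Rel.of _ _ hzw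
    funext i
    obtain ⟨w, hw, hw'⟩ := hT i
    have : extendZero ζ g w = extendZero ζ g (ζ i) :=
      (hle ((isPresentation_rel_iff hρ _ _).2 hw)).2
    rw [← happ g i, ← this]
    rcases hw' with h | ⟨j, hj, rfl⟩
    · exact happ0 g w h
    · rw [happ]; exact h2 j hj
  have := LinearMap.finrank_le_finrank_of_injective hL
  rw [Module.finrank_prod, Module.finrank_fintype_fun_eq_card, Module.finrank_fintype_fun_eq_card,
    Module.finrank_fintype_fun_eq_card, Fintype.card_coe] at this
  rw [Set.encard_eq_coe_toFinset_card, Set.toFinset_card]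
  exact_mod_cast this

/-- To see that `ρ` is a presentation, it suffices to connect each factorization that is not
unique to one that contains a fixed atom `p`: the atom can then be cancelled. -/
theorem isPresentation_of_atom {ρ : Set (Fact S × Fact S)} (p : atoms S)
    (hker : ∀ r ∈ ρ, factHom S r.1 = factHom S r.2)
    (h : ∀ z : Fact S, IsUniqueFact z ∨
      ∃ z', addConGen (fun z w => (z, w) ∈ ρ) z (single p 1 + z')) :
    IsPresentation S ρ := by
  have hle : addConGen (fun z w => (z, w) ∈ ρ) ≤ AddCon.ker (factHom S) := by
    rw [AddCon.addConGen_le]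
    exact fun z w hzw => hker (z, w) hzw
  refine le_antisymm hle ?_
  have key : ∀ n, ∀ z w : Fact S, factHom S z = n → factHom S w = n →
      addConGen (fun z w => (z, w) ∈ ρ) z w := by
    intro n
    induction n using Nat.strong_induction_on with
    | _ n ih =>
      intro z w hz hw
      rcases h z with hu | ⟨z', hz'⟩
      · rw [hu w (hw.trans hz.symm)]; exact AddCon.refl _ _
      rcases h w with hu | ⟨w', hw'⟩
      · rw [hu z (hz.trans hw.symm)]; exact AddCon.refl _ _
      have e1 : factHom S z = factHom S (single p 1 + z') := hle hz'
      have e2 : factHom S w = factHom S (single p 1 + w') := hle hw'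
      rw [map_add, factHom_single] at e1 e2
      have := p.2.2.1
      have h3 := ih (factHom S z') (by omega) z' w' rfl (by omega)
      exact (hz'.trans (AddCon.add _ (AddCon.refl _ _) h3)).trans hw'.symm
  intro z w hzw
  exact key _ z w rfl (Eq.symm hzw)

/-- A presentation of the least possible finite cardinality is automatically minimal. -/
theorem eta_eq_of_isPresentation {N : ℕ} {ρ : Set (Fact S × Fact S)} (hρ : IsPresentation S ρ)
    (hcard : ρ.encard ≤ N) (hlb : ∀ ρ', IsPresentation S ρ' → (N : ℕ∞) ≤ ρ'.encard) :
    eta S = N := by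
  have hfin : ρ.Finite := Set.finite_of_encard_le_coe hcard
  refine le_antisymm (iInf₂_le_of_le ρ ⟨hρ, fun ρ' hρ' hle => ?_⟩ hcard)
    (le_iInf₂ fun ρ' h => hlb ρ' h.1)
  exact (hfin.eq_of_subset_of_encard_le' hle (hcard.trans (hlb ρ' hρ'))).ge

end NumSgp

/-! ### Apéry sets described by a graph and a chain -/

namespace NumSgp

open Finsupp

variable {S : AddSubmonoid ℕ} {ι : Type*}

/-- The factorization `ε i + ε j` attached to the unordered pair `s(i, j)`. -/
noncomputable def quad (ε : ι → atoms S) : Sym2 ι → Fact S :=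
  Sym2.lift ⟨fun i j => single (ε i) 1 + single (ε j) 1, fun _ _ => add_comm _ _⟩

@[simp]
theorem quad_mk (ε : ι → atoms S) (i j : ι) :
    quad ε s(i, j) = single (ε i) 1 + single (ε j) 1 := rfl

theorem quad_injective {ε : ι → atoms S} (hε : Function.Injective ε) :
    Function.Injective (quad ε) := by
  intro σ τ
  induction σ with | _ i j
  induction τ with | _ k l
  intro h
  rw [quad_mk, quad_mk, single_add_single_eq_single_add_single one_ne_zero one_ne_zero] at h
  rcases h with ⟨h1, h2⟩ | ⟨_, h1, h2⟩ | h
  · rw [hε h1, hε h2]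
  · rw [hε h1, hε h2, Sym2.eq_swap]
  · simp at h

theorem isIsolated_quad (ε : ι → atoms S) (σ : Sym2 ι) : IsIsolated (quad ε σ) := by
  induction σ with | _ i j
  exact isIsolated_single_add_single _ _

open Classical in
/-- The family `quad ε`, with the square of `ε y` replaced by its `t`-th power. -/
noncomputable def quadOrPow (ε : ι → atoms S) (y : ι) (t : ℕ) (σ : Sym2 ι) : Fact S :=
  if σ = s(y, y) then single (ε y) t else quad ε σ

theorem quadOrPow_self (ε : ι → atoms S) (y : ι) (t : ℕ) :
    quadOrPow ε y t s(y, y) = single (ε y) t := if_pos rfl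

theorem quadOrPow_of_ne (ε : ι → atoms S) {y : ι} (t : ℕ) {σ : Sym2 ι} (h : σ ≠ s(y, y)) :
    quadOrPow ε y t σ = quad ε σ := if_neg h

theorem quadOrPow_injective {ε : ι → atoms S} (hε : Function.Injective ε) (y : ι) (t : ℕ) :
    Function.Injective (quadOrPow ε y t) := by
  have key : ∀ τ, τ ≠ s(y, y) → single (ε y) t ≠ quad ε τ := by
    intro τ hτ h
    induction τ with | _ i j
    have hi := DFunLike.congr_fun h (ε i)
    have hj := DFunLike.congr_fun h (ε j)
    have hi' : i = y := by
      by_contra hne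
      rw [single_eq_of_ne fun h => hne (hε h)] at hi
      simp at hi
      omega
    have hj' : j = y := by
      by_contra hne
      rw [single_eq_of_ne fun h => hne (hε h)] at hj
      simp at hj
    exact hτ (by rw [hi', hj'])
  intro σ τ h
  by_cases hσ : σ = s(y, y) <;> by_cases hτ : τ = s(y, y)
  · rw [hσ, hτ]
  · rw [hσ, quadOrPow_self, quadOrPow_of_ne _ _ hτ] at h
    exact absurd h (key τ hτ)
  · rw [hτ, quadOrPow_self, quadOrPow_of_ne _ _ hσ] at h
    exact absurd h.symm (key σ hσ)
  · rw [quadOrPow_of_ne _ _ hσ, quadOrPow_of_ne _ _ hτ] at h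
    exact quad_injective hε h

/-- The atoms of `S` are `p` and the `ε i`, and the Apéry set of `S` with respect to `p` consists
of `0`, the atoms `ε i`, the sums `ε i + ε j` over the edges of the triangle-free graph `G`, the
multiples `j * ε y` with `j < t`, and the sums `j * ε y + ε i` with `j < t` and `i` adjacent to `y`;
moreover these elements have only one factorization. This is encoded by the minimal
factorizations outside the list, whose values minus `p` lie in `S`, and by the atoms that divide the
elements of the list. -/
structure IsApery (ε : ι → atoms S) (p : atoms S) (y : ι) (t : ℕ) (G : SimpleGraph ι) :
    Prop where
  injective : Function.Injective ε
  ne_base : ∀ i, ε i ≠ p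
  cover : ∀ a, a = p ∨ ∃ i, a = ε i
  two_le : 2 ≤ t
  triangleFree : ∀ i j l, G.Adj i j → G.Adj j l → G.Adj i l → False
  nonadj : ∀ i j, ¬ G.Adj i j → s(i, j) ≠ s(y, y) → ∃ n ∈ S, (ε i : ℕ) + ε j = p + n
  pow : ∃ n ∈ S, t * (ε y : ℕ) = p + n
  of_dvd_edge : ∀ i j, G.Adj i j → i ≠ y → j ≠ y → ∀ c : atoms S,
    (∃ n ∈ S, (c : ℕ) + n = ε i + ε j) → c = ε i ∨ c = ε j
  of_dvd_pow : ∀ j < t, ∀ c : atoms S, (∃ n ∈ S, (c : ℕ) + n = j * ε y) → c = ε y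
  of_dvd_pow_add : ∀ i, G.Adj y i → ∀ j, 1 ≤ j → j < t → ∀ c : atoms S,
    (∃ n ∈ S, (c : ℕ) + n = j * ε y + ε i) → c = ε y ∨ c = ε i

namespace IsApery

variable {ε : ι → atoms S} {p : atoms S} {y : ι} {t : ℕ} {G : SimpleGraph ι}

theorem isUniqueFact_pow (h : IsApery ε p y t G) {j : ℕ} (hj : j < t) :
    IsUniqueFact (single (ε y) j) := by
  induction j with
  | zero => rw [single_zero]; exact isUniqueFact_zero
  | succ j ih =>
    refine IsUniqueFact.of_atoms (by simp) fun c hc => ?_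
    obtain rfl := h.of_dvd_pow (j + 1) hj c (by simpa only [factHom_single] using hc)
    exact ⟨single (ε y) j, by rw [← single_add, add_comm], ih (by omega)⟩

theorem isUniqueFact_pow_add (h : IsApery ε p y t G) {i : ι} (hi : G.Adj y i) {j : ℕ}
    (hj : j < t) : IsUniqueFact (single (ε y) j + single (ε i) 1) := by
  induction j with
  | zero => rw [single_zero, zero_add]; exact isUniqueFact_single _
  | succ j ih =>
    refine IsUniqueFact.of_atoms (by simp) fun c hc => ?_
    rcases h.of_dvd_pow_add i hi (j + 1) (by omega) hj c
        (by simpa only [map_add, factHom_single, one_mul] using hc) with rfl | rfl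
    · exact ⟨single (ε y) j + single (ε i) 1, by rw [← add_assoc, ← single_add, add_comm 1],
        ih (by omega)⟩
    · exact ⟨single (ε y) (j + 1), add_comm _ _, h.isUniqueFact_pow hj⟩

theorem isUniqueFact_edge (h : IsApery ε p y t G) {i j : ι} (hij : G.Adj i j) :
    IsUniqueFact (single (ε i) 1 + single (ε j) 1) := by
  have ht := h.two_le
  by_cases hi : i = y
  · subst hi; exact h.isUniqueFact_pow_add hij (by omega)
  by_cases hj : j = y
  · subst hj; rw [add_comm]; exact h.isUniqueFact_pow_add hij.symm (by omega)
  refine IsUniqueFact.of_atoms (by simp) fun c hc => ?_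
  rcases h.of_dvd_edge i j hij hi hj c (by simpa using hc) with rfl | rfl
  · exact ⟨_, rfl, isUniqueFact_single _⟩
  · exact ⟨_, add_comm _ _, isUniqueFact_single _⟩

theorem isIsolated_quadOrPow (h : IsApery ε p y t G) (σ : Sym2 ι) :
    IsIsolated (quadOrPow ε y t σ) := by
  have ht := h.two_le
  by_cases hσ : σ = s(y, y)
  · rw [hσ, quadOrPow_self]
    refine IsIsolated.of_unique fun a ha => ?_
    have : a = ε y := by
      by_contra hne
      exact ha (single_eq_of_ne hne)
    subst this
    exact ⟨single (ε y) (t - 1), by rw [← single_add]; congr 1; omega,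
      h.isUniqueFact_pow (by omega)⟩
  · rw [quadOrPow_of_ne _ _ hσ]
    exact isIsolated_quad _ _

theorem exists_base_add (h : IsApery ε p y t G) {σ : Sym2 ι} (hσ : σ ∉ G.edgeSet) :
    ∃ u, factHom S (quadOrPow ε y t σ) = factHom S (single p 1 + u) := by
  have : ∃ n ∈ S, factHom S (quadOrPow ε y t σ) = p + n := by
    by_cases hy : σ = s(y, y)
    · rw [hy, quadOrPow_self, factHom_single]; exact h.pow
    · rw [quadOrPow_of_ne _ _ hy]
      induction σ with | _ i j
      simpa using h.nonadj i j hσ hy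
  obtain ⟨n, hn, hpn⟩ := this
  obtain ⟨u, rfl⟩ := exists_factHom_eq hn
  exact ⟨u, by simpa using hpn⟩

/-- A factorization that contains neither `p` nor a minimal factorization outside the Apéry set
is one of the listed factorizations of Apéry elements. -/
theorem isUniqueFact_of_not_le (h : IsApery ε p y t G) {z : Fact S} (hp : z p = 0)
    (hz : ∀ σ ∉ G.edgeSet, ¬ quadOrPow ε y t σ ≤ z) : IsUniqueFact z := by
  classical
  have hinj := h.injective
  have hadj : ∀ i j, i ≠ j → z (ε i) ≠ 0 → z (ε j) ≠ 0 → G.Adj i j := by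
    intro i j hij hi hj
    by_contra hn
    refine hz s(i, j) hn ?_
    rw [quadOrPow_of_ne _ _ (fun e => hij (by simp at e; rw [e.1, e.2])), quad_mk]
    intro a
    have : ε i ≠ ε j := fun e => hij (hinj e)
    simp only [coe_add, Pi.add_apply, single_apply]
    split_ifs <;> simp_all <;> omega
  have hone : ∀ i, i ≠ y → z (ε i) ≤ 1 := by
    intro i hi
    by_contra! hn
    refine hz s(i, i) (by simp) ?_
    rw [quadOrPow_of_ne _ _ (fun e => hi (by simpa using e)), quad_mk, ← single_add]
    rw [Finsupp.single_le_iff]; omega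
  have hy : z (ε y) < t := by
    by_contra! hn
    refine hz s(y, y) (by simp) ?_
    rwa [quadOrPow_self, Finsupp.single_le_iff]
  have hext : ∀ w : Fact S, w p = 0 → (∀ i, w (ε i) = z (ε i)) → w = z := by
    intro w hwp hw
    ext a
    rcases h.cover a with rfl | ⟨i, rfl⟩
    · rw [hwp, hp]
    · exact hw i
  by_cases h1 : ∃ i, i ≠ y ∧ z (ε i) ≠ 0
  swap
  · push Not at h1
    rw [← hext (single (ε y) (z (ε y))) (by rw [single_eq_of_ne (h.ne_base y).symm]) ?_]
    · exact h.isUniqueFact_pow hy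
    · intro i
      rcases eq_or_ne i y with rfl | hi
      · rw [single_eq_same]
      · rw [h1 i hi, single_eq_of_ne fun e => hi (hinj e)]
  obtain ⟨i, hi, hzi⟩ := h1
  have hzi1 : z (ε i) = 1 := by have := hone i hi; omega
  by_cases h2 : ∃ j, j ≠ i ∧ j ≠ y ∧ z (ε j) ≠ 0
  · obtain ⟨j, hji, hj, hzj⟩ := h2
    have hzj1 : z (ε j) = 1 := by have := hone j hj; omega
    rw [← hext (single (ε i) 1 + single (ε j) 1)
      (by simp [single_eq_of_ne (h.ne_base i).symm, single_eq_of_ne (h.ne_base j).symm]) ?_]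
    · exact h.isUniqueFact_edge (hadj i j hji.symm hzi hzj)
    · intro l
      rcases eq_or_ne l i with rfl | hli
      · simp [single_eq_of_ne fun e => hji.symm (hinj e), hzi1]
      rcases eq_or_ne l j with rfl | hlj
      · simp [single_eq_of_ne fun e => hji (hinj e), hzj1]
      by_contra hne
      have hl : z (ε l) ≠ 0 := by
        simpa [single_eq_of_ne fun e => hli (hinj e), single_eq_of_ne fun e => hlj (hinj e),
          eq_comm] using hne
      exact h.triangleFree i j l (hadj i j hji.symm hzi hzj) (hadj j l hlj.symm hzj hl)
        (hadj i l hli.symm hzi hl)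
  · push Not at h2
    rw [← hext (single (ε y) (z (ε y)) + single (ε i) 1)
      (by simp [single_eq_of_ne (h.ne_base i).symm, single_eq_of_ne (h.ne_base y).symm]) ?_]
    · by_cases hzy : z (ε y) = 0
      · rw [hzy, single_zero, zero_add]; exact isUniqueFact_single _
      · exact h.isUniqueFact_pow_add (hadj y i hi.symm hzy hzi) hy
    · intro l
      rcases eq_or_ne l i with rfl | hli
      · simp [single_eq_of_ne fun e => hi (hinj e), hzi1]
      rcases eq_or_ne l y with rfl | hly
      · simp [single_eq_of_ne fun e => hli (hinj e)]
      · simp [single_eq_of_ne fun e => hly (hinj e), single_eq_of_ne fun e => hli (hinj e),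
          h2 l hli hly]

/-- The minimal factorizations outside the Apéry set are indexed by the non-edges of `G`, loops
included, and each of them accounts for one pair of a minimal presentation. -/
theorem eta_eq [Fintype ι] [DecidableEq ι] [DecidableRel G.Adj] (h : IsApery ε p y t G) :
    eta S = (((Fintype.card ι + 1).choose 2 - G.edgeFinset.card : ℕ) : ℕ∞) := by
  classical
  have hcard : Fintype.card (Sym2 ι) = (Fintype.card ι + 1).choose 2 := Sym2.card
  choose! φ hφ using fun σ => h.exists_base_add (σ := σ)
  let f : Sym2 ι → Fact S × Fact S := fun σ => (quadOrPow ε y t σ, single p 1 + φ σ)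
  refine eta_eq_of_isPresentation (ρ := f '' (G.edgeFinsetᶜ : Finset (Sym2 ι))) ?_ ?_ ?_
  · refine isPresentation_of_atom p ?_ fun z => ?_
    · rintro _ ⟨σ, hσ, rfl⟩
      exact hφ σ (by simpa using hσ)
    by_cases hp : z p = 0
    swap
    · obtain ⟨z', rfl⟩ := exists_single_add_of_pos hp
      exact Or.inr ⟨z', AddCon.refl _ _⟩
    by_cases hz : ∃ σ ∉ G.edgeSet, quadOrPow ε y t σ ≤ z
    · obtain ⟨σ, hσ, hle⟩ := hz
      obtain ⟨u, rfl⟩ := exists_add_of_le hle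
      refine Or.inr ⟨φ σ + u, ?_⟩
      rw [← add_assoc]
      exact AddCon.add _ (AddConGen.Rel.of _ _ ⟨σ, by simpa using hσ, rfl⟩) (AddCon.refl _ _)
    · push Not at hz
      exact Or.inl (h.isUniqueFact_of_not_le hp hz)
  · refine (Set.encard_image_le _ _).trans ?_
    rw [Set.encard_coe_eq_coe_finsetCard, Finset.card_compl, hcard]
  · intro ρ' hρ'
    have hlb := card_le_encard_add_card (quadOrPow ε y t)
      (quadOrPow_injective h.injective y t) h.isIsolated_quadOrPow G.edgeFinset ?_ hρ'
    · rw [hcard] at hlb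
      rw [ENat.natCast_sub]
      exact tsub_le_iff_right.2 hlb
    intro σ
    by_cases hσ : σ ∈ G.edgeSet
    · exact ⟨_, rfl, Or.inr ⟨σ, by simpa using hσ, rfl⟩⟩
    obtain ⟨u, hu⟩ := h.exists_base_add hσ
    refine ⟨_, hu.symm, Or.inl fun τ e => ?_⟩
    have h0 : quadOrPow ε y t τ p = 0 := by
      by_cases hτ : τ = s(y, y)
      · rw [hτ, quadOrPow_self, single_eq_of_ne (h.ne_base y).symm]
      · rw [quadOrPow_of_ne _ _ hτ]
        induction τ with | _ i j
        simp [single_eq_of_ne (h.ne_base i).symm, single_eq_of_ne (h.ne_base j).symm]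
    rw [← e] at h0
    simp at h0

theorem embDim_eq [Fintype ι] (h : IsApery ε p y t G) : embDim S = Fintype.card ι + 1 := by
  classical
  let f : Option ι → atoms S := fun o => o.elim p ε
  have hf : Function.Bijective f := by
    constructor
    · rintro (_ | i) (_ | j) hij
      · rfl
      · exact absurd hij.symm (h.ne_base j)
      · exact absurd hij (h.ne_base i)
      · exact congrArg some (h.injective hij)
    · intro a
      rcases h.cover a with rfl | ⟨i, rfl⟩
      · exact ⟨none, rfl⟩
      · exact ⟨some i, rfl⟩
  rw [embDim, ← Nat.card_coe_set_eq, ← Nat.card_eq_of_bijective f hf, Nat.card_eq_fintype_card,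
    Fintype.card_option]

end IsApery

end NumSgp

/-! ### Semigroups given by Kunz coordinates -/

namespace NumSgp

open Finsupp

/-- The Kunz conditions on the function `κ`, restricted to the residues `i < m`: they say that
the numbers `κ i * m + i` are the Apéry elements, with respect to `m`, of a numerical semigroup of
multiplicity `m`. -/
structure IsKunz (m : ℕ) (κ : ℕ → ℕ) : Prop where
  pos : 0 < m
  map_zero : κ 0 = 0
  one_le : ∀ i, 0 < i → i < m → 1 ≤ κ i
  add_le : ∀ a b, a < m → b < m → a + b < m → κ (a + b) ≤ κ a + κ b
  add_sub_le : ∀ a b, a < m → b < m → m ≤ a + b → κ (a + b - m) ≤ κ a + κ b + 1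

/-- The numerical semigroup with Kunz coordinates `κ`. -/
def IsKunz.semigroup {m : ℕ} {κ : ℕ → ℕ} (h : IsKunz m κ) : AddSubmonoid ℕ where
  carrier := {n | κ (n % m) ≤ n / m}
  zero_mem' := by simp [h.map_zero]
  add_mem' := by
    intro a b ha hb
    simp only [Set.mem_ofPred_eq] at *
    have ha' := Nat.mod_lt a h.pos
    have hb' := Nat.mod_lt b h.pos
    rw [Nat.add_div h.pos, Nat.add_mod]
    split_ifs with hc
    · have := h.add_sub_le _ _ ha' hb' hc
      rw [Nat.mod_eq_sub_mod hc, Nat.mod_eq_of_lt (by omega)]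
      omega
    · have := h.add_le _ _ ha' hb' (by omega)
      rw [Nat.mod_eq_of_lt (by omega)]
      omega

/-- The Apéry element of residue `l` is the sum of those of residues `a` and `b`. The inequalities
opposite to the two in the definition are part of the Kunz conditions. -/
def Splits (m : ℕ) (κ : ℕ → ℕ) (l a b : ℕ) : Prop :=
  (a + b = l ∧ κ a + κ b ≤ κ l) ∨ (a + b = l + m ∧ κ a + κ b + 1 ≤ κ l)

theorem Splits.symm {m l a b : ℕ} {κ : ℕ → ℕ} (h : Splits m κ l a b) : Splits m κ l b a := by
  unfold Splits at *
  omega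

namespace IsKunz

variable {m : ℕ} {κ : ℕ → ℕ}

theorem mem_iff (h : IsKunz m κ) {q i : ℕ} (hi : i < m) :
    q * m + i ∈ h.semigroup ↔ κ i ≤ q := by
  change κ ((q * m + i) % m) ≤ (q * m + i) / m ↔ _
  rw [Nat.mul_add_mod', Nat.mod_eq_of_lt hi, mul_comm, Nat.mul_add_div h.pos,
    Nat.div_eq_of_lt hi, add_zero]

theorem exists_of_mem (h : IsKunz m κ) {n : ℕ} (hn : n ∈ h.semigroup) :
    ∃ q i, i < m ∧ κ i ≤ q ∧ n = q * m + i :=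
  ⟨n / m, n % m, Nat.mod_lt _ h.pos, hn, (Nat.div_add_mod' n m).symm⟩

theorem eq_of_mul_add_eq {q q' i i' : ℕ} (hi : i < m) (hi' : i' < m)
    (h : q * m + i = q' * m + i') : q = q' ∧ i = i' := by
  have h1 : (q * m + i) % m = i := by rw [Nat.mul_add_mod', Nat.mod_eq_of_lt hi]
  have h2 : (q' * m + i') % m = i' := by rw [Nat.mul_add_mod', Nat.mod_eq_of_lt hi']
  have h3 : i = i' := by rw [← h1, ← h2, h]
  subst h3
  exact ⟨Nat.eq_of_mul_eq_mul_right (by omega) (Nat.add_right_cancel h), rfl⟩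

theorem splits_of_add_eq (h : IsKunz m κ) {a l n : ℕ} (ha : a < m) (hl : l < m)
    (hn : n ∈ h.semigroup) (e : κ a * m + a + n = κ l * m + l) :
    ∃ b < m, n % m = b ∧ Splits m κ l a b := by
  obtain ⟨q, b, hb, hq, rfl⟩ := h.exists_of_mem hn
  refine ⟨b, hb, by rw [Nat.mul_add_mod', Nat.mod_eq_of_lt hb], ?_⟩
  by_cases hab : a + b < m
  · obtain ⟨h1, h2⟩ := eq_of_mul_add_eq (q := κ a + q) hab hl (by rw [← e]; ring)
    exact Or.inl ⟨h2, by omega⟩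
  · obtain ⟨c, hc⟩ := Nat.exists_eq_add_of_le (not_lt.1 hab)
    obtain ⟨h1, h2⟩ := eq_of_mul_add_eq (q := κ a + q + 1) (i := c) (by omega) hl (by
      rw [← e]
      calc (κ a + q + 1) * m + c = κ a * m + q * m + (m + c) := by ring
        _ = _ := by rw [← hc]; ring)
    exact Or.inr ⟨by omega, by omega⟩

theorem mul_add_mem (h : IsKunz m κ) {l : ℕ} (hl : l < m) : κ l * m + l ∈ h.semigroup :=
  (h.mem_iff hl).2 le_rfl

theorem self_mem (h : IsKunz m κ) : m ∈ h.semigroup := by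
  have := h.mem_iff (q := 1) h.pos
  rw [h.map_zero] at this
  simpa using this

theorem isNumericalSemigroup (h : IsKunz m κ) : IsNumericalSemigroup h.semigroup := by
  obtain ⟨K, hK⟩ : ∃ K, ∀ i < m, κ i ≤ K := by
    refine ⟨∑ i ∈ Finset.range m, κ i, fun i hi => ?_⟩
    exact Finset.single_le_sum (f := κ) (fun _ _ => Nat.zero_le _) (Finset.mem_range.2 hi)
  refine (Set.finite_lt_nat (K * m)).subset fun n hn => ?_
  by_contra hlt
  refine hn ((hK _ (Nat.mod_lt n h.pos)).trans ?_)
  rw [Nat.le_div_iff_mul_le h.pos]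
  exact not_lt.1 hlt

theorem le_of_mem (h : IsKunz m κ) {n : ℕ} (hn : n ∈ h.semigroup) (h0 : n ≠ 0) : m ≤ n := by
  obtain ⟨q, i, hi, hq, rfl⟩ := h.exists_of_mem hn
  have : q ≠ 0 := by
    rintro rfl
    have : i ≠ 0 := by simpa using h0
    have := h.one_le i (by omega) hi
    omega
  nlinarith [Nat.one_le_iff_ne_zero.2 this]

theorem mult_eq (h : IsKunz m κ) : mult h.semigroup = m := by
  refine le_antisymm (Nat.sInf_le ⟨h.self_mem, h.pos.ne'⟩) ?_
  exact le_csInf ⟨m, h.self_mem, h.pos.ne'⟩ fun n hn => h.le_of_mem hn.1 hn.2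

theorem self_mem_atoms (h : IsKunz m κ) : m ∈ atoms h.semigroup := by
  refine ⟨h.self_mem, h.pos.ne', fun a ha b hb hab => ?_⟩
  by_contra! hc
  have := h.le_of_mem ha hc.1
  have := h.le_of_mem hb hc.2
  have := h.pos
  omega

theorem not_self_add_eq (h : IsKunz m κ) {l n : ℕ} (hl : l < m)
    (hn : n ∈ h.semigroup) : m + n ≠ κ l * m + l := by
  intro e
  obtain ⟨q, b, hb, hq, rfl⟩ := h.exists_of_mem hn
  obtain ⟨h1, rfl⟩ := eq_of_mul_add_eq (q := q + 1) hb hl (by rw [← e]; ring)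
  omega

theorem mem_atoms (h : IsKunz m κ) {l : ℕ} (hl : l < m) (hl0 : 0 < l)
    (hs : ∀ a b, 0 < a → a < m → 0 < b → b < m → ¬ Splits m κ l a b) :
    κ l * m + l ∈ atoms h.semigroup := by
  refine ⟨h.mul_add_mem hl, by omega, fun x hx y hy hxy => ?_⟩
  obtain ⟨q, a, ha, hq, rfl⟩ := h.exists_of_mem hx
  obtain ⟨d, rfl⟩ := Nat.exists_eq_add_of_le hq
  obtain ⟨b, hb, hyb, hsp⟩ := h.splits_of_add_eq (n := d * m + y) ha hl
    (add_mem (by simpa using nsmul_mem h.self_mem d) hy) (by rw [← hxy]; ring)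
  rcases Nat.eq_zero_or_pos a with rfl | ha0
  · rcases Nat.eq_zero_or_pos (κ 0 + d) with h0 | h0
    · left; rw [h0]; simp
    · obtain ⟨d', hd'⟩ := Nat.exists_eq_succ_of_ne_zero h0.ne'
      refine absurd ?_ (h.not_self_add_eq (n := d' * m + y) hl
        (add_mem (by simpa using nsmul_mem h.self_mem d') hy))
      rw [← hxy, hd', Nat.succ_mul]; ring
  rcases Nat.eq_zero_or_pos b with hb0 | hb0
  · right
    rw [Nat.mul_add_mod', hb0] at hyb
    obtain ⟨c, rfl⟩ := Nat.dvd_of_mod_eq_zero hyb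
    rcases Nat.eq_zero_or_pos c with rfl | hc
    · simp
    · obtain ⟨c', rfl⟩ := Nat.exists_eq_succ_of_ne_zero hc.ne'
      refine absurd ?_ (h.not_self_add_eq (n := (κ a + d) * m + a + c' * m) hl
        (add_mem hx (by simpa using nsmul_mem h.self_mem c')))
      rw [← hxy, Nat.mul_succ]; ring
  · exact absurd hsp (hs a b ha0 ha hb0 hb)

theorem mul_add_add_mul_add (h : IsKunz m κ) {l a b : ℕ} (ha : a < m) (hb : b < m) (hl : l < m)
    (hs : Splits m κ l a b) : κ a * m + a + (κ b * m + b) = κ l * m + l := by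
  rcases hs with ⟨rfl, hs⟩ | ⟨e, hs⟩
  · rw [le_antisymm (h.add_le a b ha hb hl) hs]; ring
  · have := h.add_sub_le a b ha hb (by omega)
    rw [e, Nat.add_sub_cancel] at this
    rw [le_antisymm this hs]
    linear_combination e

theorem eq_of_mem_atoms (h : IsKunz m κ) {n : ℕ} (hn : n ∈ atoms h.semigroup) :
    n = m ∨ ∃ l, 0 < l ∧ l < m ∧ n = κ l * m + l ∧
      ∀ a b, 0 < a → a < m → 0 < b → b < m → ¬ Splits m κ l a b := by
  obtain ⟨hmem, h0, hirr⟩ := hn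
  obtain ⟨q, l, hl, hq, rfl⟩ := h.exists_of_mem hmem
  have hm := h.pos
  rcases hq.eq_or_lt with rfl | hlt
  · right
    have hl0 : 0 < l := by
      rcases Nat.eq_zero_or_pos l with rfl | hl0
      · simp [h.map_zero] at h0
      · exact hl0
    refine ⟨l, hl0, hl, rfl, fun a b ha0 ha hb0 hb hs => ?_⟩
    rcases hirr _ (h.mul_add_mem ha) _ (h.mul_add_mem hb) (h.mul_add_add_mul_add ha hb hl hs)
      with h | h <;> omega
  · left
    obtain ⟨d, rfl⟩ := Nat.exists_eq_add_of_lt hlt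
    have hmem' : (κ l + d) * m + l ∈ h.semigroup := (h.mem_iff hl).2 (by omega)
    rcases hirr _ h.self_mem _ hmem' (by ring) with h | h
    · omega
    · rw [Nat.add_mul, Nat.one_mul]; omega

/-- A criterion, in terms of Kunz coordinates, for the Apéry set of a numerical semigroup with
respect to its multiplicity `m` to be described by a chain of multiples of the atom of residue `1`
and a graph. -/
theorem exists_isApery (h : IsKunz m κ) {ι : Type*} {res : ι → ℕ} {y : ι} {t : ℕ}
    {G : SimpleGraph ι} (hinj : Function.Injective res) (hpos : ∀ i, 0 < res i)
    (hlt : ∀ i, res i < m) (hy : res y = 1)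
    (hirr : ∀ i a b, 0 < a → a < m → 0 < b → b < m → ¬ Splits m κ (res i) a b)
    (hred : ∀ l, 0 < l → l < m → (∀ i, res i ≠ l) →
      ∃ a b, 0 < a ∧ a < m ∧ 0 < b ∧ b < m ∧ Splits m κ l a b)
    (htri : ∀ i j l, G.Adj i j → G.Adj j l → G.Adj i l → False)
    (hnon : ∀ i j, ¬ G.Adj i j → s(i, j) ≠ s(y, y) →
      (res i + res j < m ∧ κ (res i + res j) < κ (res i) + κ (res j)) ∨
      (m ≤ res i + res j ∧ κ (res i + res j - m) < κ (res i) + κ (res j) + 1))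
    (ht : 2 ≤ t) (htm : t < m) (hpow : κ t < t * κ 1)
    (hedge : ∀ i j, G.Adj i j → ∃ l < m, Splits m κ l (res i) (res j) ∧
      ∀ c b, b < m → Splits m κ l (res c) b → c = i ∨ c = j)
    (hchain : ∀ j < t, κ j = j * κ 1 ∧ ∀ c b, b < m → Splits m κ j (res c) b → c = y)
    (hchain_edge : ∀ i, G.Adj y i → t = 2) :
    ∃ (ε : ι → atoms h.semigroup) (p : atoms h.semigroup), IsApery ε p y t G := by
  let ε : ι → atoms h.semigroup := fun i =>
    ⟨κ (res i) * m + res i, h.mem_atoms (hlt i) (hpos i) (hirr i)⟩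
  let p : atoms h.semigroup := ⟨m, h.self_mem_atoms⟩
  have hcov : ∀ a : atoms h.semigroup, a = p ∨ ∃ i, a = ε i := by
    rintro ⟨a, ha⟩
    rcases h.eq_of_mem_atoms ha with rfl | ⟨l, hl0, hl, rfl, hs⟩
    · exact Or.inl rfl
    · right
      by_contra! hc
      obtain ⟨a, b, ha0, ha, hb0, hb, hab⟩ := hred l hl0 hl fun i hi => hc i (by
        apply Subtype.ext; simp only [ε, hi])
      exact hs a b ha0 ha hb0 hb hab
  have hdvd : ∀ l < m, ∀ c : atoms h.semigroup,
      (∃ n ∈ h.semigroup, (c : ℕ) + n = κ l * m + l) →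
      ∃ i b, c = ε i ∧ b < m ∧ Splits m κ l (res i) b := by
    rintro l hl c ⟨n, hn, e⟩
    rcases hcov c with rfl | ⟨i, rfl⟩
    · exact absurd e (h.not_self_add_eq hl hn)
    · obtain ⟨b, hb, -, hs⟩ := h.splits_of_add_eq (hlt i) hl hn e
      exact ⟨i, b, rfl, hb, hs⟩
  have hof_edge : ∀ i j, G.Adj i j → ∀ c : atoms h.semigroup,
      (∃ n ∈ h.semigroup, (c : ℕ) + n = ε i + ε j) → c = ε i ∨ c = ε j := by
    intro i j hij c hc
    obtain ⟨l, hl, hs, hlc⟩ := hedge i j hij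
    have e := h.mul_add_add_mul_add (hlt i) (hlt j) hl hs
    obtain ⟨k, b, rfl, hb, hsb⟩ := hdvd l hl c (by rwa [← e])
    rcases hlc k b hb hsb with rfl | rfl
    · exact Or.inl rfl
    · exact Or.inr rfl
  refine ⟨ε, p, ?_, ?_, hcov, ht, htri, ?_, ?_, fun i j hij _ _ => hof_edge i j hij, ?_, ?_⟩
  · intro i j hij
    have := congrArg Subtype.val hij
    exact hinj (eq_of_mul_add_eq (hlt i) (hlt j) this).2
  · intro i hi
    have : κ (res i) * m + res i = 1 * m + 0 := by
      have := congrArg Subtype.val hi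
      simpa [ε, p] using this
    have := (eq_of_mul_add_eq (hlt i) h.pos this).2
    have := hpos i
    omega
  · intro i j hij hne
    rcases hnon i j hij hne with ⟨hm, hk⟩ | ⟨hm, hk⟩
    · obtain ⟨d, hd⟩ := Nat.exists_eq_add_of_lt hk
      refine ⟨(κ (res i + res j) + d) * m + (res i + res j), (h.mem_iff hm).2 (by omega), ?_⟩
      calc κ (res i) * m + res i + (κ (res j) * m + res j)
          = (κ (res i) + κ (res j)) * m + (res i + res j) := by ring
        _ = _ := by rw [hd]; ring
    · obtain ⟨d, hd⟩ := Nat.exists_eq_add_of_le (Nat.lt_succ_iff.1 hk)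
      obtain ⟨l, hl⟩ := Nat.exists_eq_add_of_le hm
      have := hlt i
      have := hlt j
      have hl' : res i + res j - m = l := by omega
      rw [hl'] at hd
      refine ⟨(κ l + d) * m + l, (h.mem_iff (by omega)).2 (by omega), ?_⟩
      calc κ (res i) * m + res i + (κ (res j) * m + res j)
          = (κ (res i) + κ (res j)) * m + (res i + res j) := by ring
        _ = _ := by rw [hd, hl]; ring
  · obtain ⟨d, hd⟩ := Nat.exists_eq_add_of_lt hpow
    refine ⟨(κ t + d) * m + t, (h.mem_iff htm).2 (by omega), ?_⟩
    calc t * (κ (res y) * m + res y) = (t * κ 1) * m + t := by rw [hy]; ring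
      _ = _ := by rw [hd]; ring
  · intro j hj c hc
    have e : j * (ε y : ℕ) = κ j * m + j := by
      rw [(hchain j hj).1]
      change j * (κ (res y) * m + res y) = _
      rw [hy]; ring
    rw [e] at hc
    obtain ⟨k, b, rfl, hb, hs⟩ := hdvd j (by omega) c hc
    rw [(hchain j hj).2 k b hb hs]
  · intro i hi j hj1 hjt c hc
    obtain rfl : j = 1 := by have := hchain_edge i hi; omega
    exact hof_edge y i hi c (by simpa using hc)

end IsKunz

/-- The number of edges of a graph, from an enumeration without repetitions. -/
theorem card_edgeFinset_eq {ι : Type*} [Fintype ι] [DecidableEq ι] {G : SimpleGraph ι}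
    [DecidableRel G.Adj] {n : ℕ} (f : Fin n → Sym2 ι) (hf : Function.Injective f)
    (h : ∀ i j, G.Adj i j ↔ ∃ x, f x = s(i, j)) : G.edgeFinset.card = n := by
  have : G.edgeFinset = Finset.univ.image f := by
    ext σ
    induction σ with | _ i j
    simp [h]
  rw [this, Finset.card_image_of_injective _ hf, Finset.card_univ, Fintype.card_fin]

end NumSgp

/-! ### Semigroups whose graph is a star -/

namespace NumSgp

/-- The Kunz coordinates of a semigroup whose Apéry elements are the multiples `j * y` of the atom
`y` of residue `1` for `j < t`, the other atoms, and the sums of the atom of residue `t + s` with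
the atoms of the last `s` residues; these sums have the residues from `t` to `t + s - 1`. The
coordinates `2 * t - 2` and `2 * t - 1` of the other atoms are such that a sum of two of them lies
above `(t - 1) * y`, while `t * y` lies above the `s` listed sums; they differ, so that a sum of two
atoms of coordinate `2 * t - 1` lies above the listed sums. -/
def starCoord (s t j : ℕ) : ℕ :=
  if j < t then 4 * j else if j < t + s then 4 * t - 2 else if j = t + s then 2 * t - 2
  else 2 * t - 1

theorem starCoord_cases (s t j : ℕ) : (j < t ∧ starCoord s t j = 4 * j) ∨
    (t ≤ j ∧ j < t + s ∧ starCoord s t j = 4 * t - 2) ∨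
    (t ≤ j ∧ j = t + s ∧ starCoord s t j = 2 * t - 2) ∨
    (t + s < j ∧ starCoord s t j = 2 * t - 1) := by
  unfold starCoord; split_ifs <;> omega

theorem isKunz_starCoord {k s t : ℕ} (ht : 2 ≤ t) (hs : s + 2 ≤ k) :
    IsKunz (k + s + t - 1) (starCoord s t) := by
  constructor
  · omega
  · have := starCoord_cases s t 0; omega
  · intro i hi him
    have := starCoord_cases s t i; omega
  · intro a b ha hb hab
    have := starCoord_cases s t a
    have := starCoord_cases s t b
    have := starCoord_cases s t (a + b)
    omega
  · intro a b ha hb hab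
    have := starCoord_cases s t a
    have := starCoord_cases s t b
    have := starCoord_cases s t (a + b - (k + s + t - 1))
    omega

/-- The residues of the atoms of the semigroup with Kunz coordinates `starCoord s t`. -/
def starRes (s t i : ℕ) : ℕ := if i = 0 then 1 else t + s + i - 1

theorem starRes_cases (s t i : ℕ) : (i = 0 ∧ starRes s t i = 1) ∨
    (0 < i ∧ starRes s t i = t + s + i - 1) := by
  unfold starRes; split_ifs <;> omega

theorem not_splits_starRes {k s t i a b : ℕ} (ht : 2 ≤ t)
    (ha0 : 0 < a) (ha : a < k + s + t - 1) (hb0 : 0 < b) (hb : b < k + s + t - 1) :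
    ¬ Splits (k + s + t - 1) (starCoord s t) (starRes s t i) a b := by
  have := starCoord_cases s t a
  have := starCoord_cases s t b
  have := starRes_cases s t i
  have := starCoord_cases s t (starRes s t i)
  unfold Splits
  omega

theorem exists_splits_star {k s t l : ℕ} (ht : 2 ≤ t) (hs : s + 2 ≤ k) (hl0 : 0 < l)
    (hl : l < k + s + t - 1) (hne : ∀ i < k, starRes s t i ≠ l) :
    ∃ a b, 0 < a ∧ a < k + s + t - 1 ∧ 0 < b ∧ b < k + s + t - 1 ∧
      Splits (k + s + t - 1) (starCoord s t) l a b := by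
  have := starCoord_cases s t l
  by_cases h1 : l < t
  · have := hne 0 (by omega)
    have := starRes_cases s t 0
    refine ⟨1, l - 1, by omega, by omega, by omega, by omega, ?_⟩
    have := starCoord_cases s t 1
    have := starCoord_cases s t (l - 1)
    unfold Splits
    omega
  · have h2 : l < t + s := by
      by_contra hc
      have := hne (l + 1 - t - s) (by omega)
      have := starRes_cases s t (l + 1 - t - s)
      omega
    refine ⟨t + s, l + k - 1, by omega, by omega, by omega, by omega, ?_⟩
    have := starCoord_cases s t (t + s)
    have := starCoord_cases s t (l + k - 1)
    unfold Splits
    omega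

theorem splits_star_edge {k s t i j : ℕ} (ht : 2 ≤ t) (hs : s + 2 ≤ k) (hi : i = 1)
    (hj : k - s ≤ j)
    (hjk : j < k) : Splits (k + s + t - 1) (starCoord s t) (t + s + j - k) (starRes s t i)
      (starRes s t j) ∧ ∀ c < k, ∀ b < k + s + t - 1,
      Splits (k + s + t - 1) (starCoord s t) (t + s + j - k) (starRes s t c) b →
        c = i ∨ c = j := by
  subst hi
  have := starCoord_cases s t (t + s + j - k)
  constructor
  · have := starRes_cases s t 1
    have := starRes_cases s t j
    have := starCoord_cases s t (starRes s t 1)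
    have := starCoord_cases s t (starRes s t j)
    unfold Splits
    omega
  · intro c hc b hb
    have := starRes_cases s t c
    have := starCoord_cases s t (starRes s t c)
    have := starCoord_cases s t b
    unfold Splits
    omega

theorem starCoord_nonadj {k s t i j : ℕ} (ht : 2 ≤ t) (hs : s + 2 ≤ k) (hi : i < k) (hj : j < k)
    (hij : ¬ ((i = 1 ∧ k - s ≤ j) ∨ (j = 1 ∧ k - s ≤ i))) (hne : ¬ (i = 0 ∧ j = 0)) :
    (starRes s t i + starRes s t j < k + s + t - 1 ∧
      starCoord s t (starRes s t i + starRes s t j) <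
        starCoord s t (starRes s t i) + starCoord s t (starRes s t j)) ∨
    (k + s + t - 1 ≤ starRes s t i + starRes s t j ∧
      starCoord s t (starRes s t i + starRes s t j - (k + s + t - 1)) <
        starCoord s t (starRes s t i) + starCoord s t (starRes s t j) + 1) := by
  have h1 := starRes_cases s t i
  have h2 := starRes_cases s t j
  have := starCoord_cases s t (starRes s t i)
  have := starCoord_cases s t (starRes s t j)
  have := starCoord_cases s t (starRes s t i + starRes s t j)
  have := starCoord_cases s t (starRes s t i + starRes s t j - (k + s + t - 1))
  rcases h1 with h1 | h1 <;> rcases h2 with h2 | h2 <;> omega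

theorem eq_zero_of_splits_star {k s t j c b : ℕ} (ht : 2 ≤ t) (hj : j < t)
    (hc : c < k) (hb : b < k + s + t - 1)
    (h : Splits (k + s + t - 1) (starCoord s t) j (starRes s t c) b) : c = 0 := by
  have := starRes_cases s t c
  have := starCoord_cases s t (starRes s t c)
  have := starCoord_cases s t b
  have := starCoord_cases s t j
  unfold Splits at h
  omega

/-- The atom `y` has index `0`, and the atom of index `1` is the centre of a star with `s` leaves.
Lengthening the chain of multiples of `y` increases the multiplicity but not the number of
relations. -/
theorem exists_star {k s t : ℕ} (ht : 2 ≤ t) (hs : s + 2 ≤ k) :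
    ∃ S : AddSubmonoid ℕ, IsNumericalSemigroup S ∧ embDim S = k + 1 ∧
      mult S = k + s + t - 1 ∧ eta S = (((k + 1).choose 2 - s : ℕ) : ℕ∞) := by
  classical
  have h := isKunz_starCoord ht hs
  let G : SimpleGraph (Fin k) :=
    { Adj := fun i j => (i.1 = 1 ∧ k - s ≤ j.1) ∨ (j.1 = 1 ∧ k - s ≤ i.1)
      symm := ⟨fun _ _ h => h.symm⟩
      loopless := ⟨fun i h => by omega⟩ }
  have hG : ∀ i j, G.Adj i j ↔ (i.1 = 1 ∧ k - s ≤ j.1) ∨ (j.1 = 1 ∧ k - s ≤ i.1) :=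
    fun _ _ => Iff.rfl
  obtain ⟨ε, p, hA⟩ := h.exists_isApery (res := fun i : Fin k => starRes s t i)
    (y := ⟨0, by omega⟩) (t := t) (G := G)
    (by
      intro i j hij
      have := starRes_cases s t i
      have := starRes_cases s t j
      apply Fin.ext
      simp only at hij
      omega)
    (by intro i; have := starRes_cases s t i; omega)
    (by intro i; have := starRes_cases s t i; omega)
    rfl
    (fun i a b ha0 ha hb0 hb => not_splits_starRes ht ha0 ha hb0 hb)
    (fun l hl0 hl hne => exists_splits_star ht hs hl0 hl fun i hi => hne ⟨i, hi⟩)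
    (by
      intro i j l hij hjl hil
      rw [hG] at *
      omega)
    (by
      intro i j hij hne
      refine starCoord_nonadj ht hs i.2 j.2 hij ?_
      rintro ⟨h1, h2⟩
      exact hne (Sym2.eq_iff.2 (Or.inl ⟨Fin.ext h1, Fin.ext h2⟩)))
    ht (by omega)
    (by
        have := starCoord_cases s t t
        have := starCoord_cases s t 1
        have : starCoord s t 1 = 4 := by omega
        rw [this]; omega)
    (by
      intro i j hij
      rcases hij with ⟨hi, hj⟩ | ⟨hj, hi⟩
      · obtain ⟨h2, h3⟩ := splits_star_edge (t := t) ht hs hi hj j.2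
        exact ⟨_, by omega, h2, fun c b hb hs => by simpa [Fin.ext_iff] using h3 c c.2 b hb hs⟩
      · obtain ⟨h2, h3⟩ := splits_star_edge (t := t) ht hs hj hi i.2
        exact ⟨_, by omega, h2.symm,
          fun c b hb hs => by simpa [Fin.ext_iff, or_comm] using h3 c c.2 b hb hs⟩)
    (by
      intro j hj
      refine ⟨?_, fun c b hb h => Fin.ext (eq_zero_of_splits_star ht hj c.2 hb h)⟩
      have := starCoord_cases s t j
      have := starCoord_cases s t 1
      have : starCoord s t 1 = 4 := by omega
      rw [this]; omega)
    (by
      intro i hi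
      rw [hG] at hi
      simp only at hi
      omega)
  have hcard : G.edgeFinset.card = s := by
    refine card_edgeFinset_eq (fun x => s(⟨1, by omega⟩, ⟨k - s + x.1, by omega⟩)) ?_ ?_
    · intro x x' hx
      simp [Fin.ext_iff] at hx
      apply Fin.ext
      omega
    · intro i j
      rw [hG]
      simp only [Sym2.eq_iff, Fin.ext_iff]
      constructor
      · rintro (⟨h1, h2⟩ | ⟨h1, h2⟩)
        · exact ⟨⟨j.1 - (k - s), by omega⟩, by simp only; omega⟩
        · exact ⟨⟨i.1 - (k - s), by omega⟩, by simp only; omega⟩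
      · rintro ⟨x, hx⟩
        omega
  exact ⟨h.semigroup, h.isNumericalSemigroup, by simpa using hA.embDim_eq, h.mult_eq,
    by simpa [hcard] using hA.eta_eq⟩

end NumSgp

/-! ### Semigroups whose graph has as many edges as vertices -/

namespace NumSgp

/-- The Kunz coordinates of a semigroup of odd multiplicity whose Apéry elements are `0`, the atoms,
of residues `1`, `2`, `3`, `6`, `9`, `11`, `13`, ..., and the sums of two atoms `1 + b` for
`b ≥ 3`, `2 + 3` and `2 + 6`. No sum of two atoms of residues at least `3` is an Apéry element,
since its coordinate is at least `20`. -/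
def bipartiteCoord (j : ℕ) : ℕ :=
  if j = 0 then 0 else if j = 1 then 6 else if j = 2 then 9 else if j = 5 ∨ j = 8 then 19
  else if j = 3 ∨ j = 6 ∨ (9 ≤ j ∧ j % 2 = 1) then 10 else 16

theorem bipartiteCoord_cases (j : ℕ) : (j = 0 ∧ bipartiteCoord j = 0) ∨
    (j = 1 ∧ bipartiteCoord j = 6) ∨ (j = 2 ∧ bipartiteCoord j = 9) ∨
    ((j = 5 ∨ j = 8) ∧ bipartiteCoord j = 19) ∨
    ((j = 3 ∨ j = 6 ∨ (9 ≤ j ∧ j % 2 = 1)) ∧ bipartiteCoord j = 10) ∨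
    ((j = 4 ∨ j = 7 ∨ (9 ≤ j ∧ j % 2 = 0)) ∧ bipartiteCoord j = 16) := by
  unfold bipartiteCoord; split_ifs <;> omega

theorem bipartiteCoord_bounds (j : ℕ) : bipartiteCoord j ≤ 19 ∧
    (0 < j → 6 ≤ bipartiteCoord j) ∧ (3 ≤ j → 10 ≤ bipartiteCoord j) := by
  have := bipartiteCoord_cases j
  omega

theorem bipartiteCoord_zero : bipartiteCoord 0 = 0 := rfl
theorem bipartiteCoord_one : bipartiteCoord 1 = 6 := rfl
theorem bipartiteCoord_two : bipartiteCoord 2 = 9 := rfl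

/-- The residues of the atoms of the semigroup with Kunz coordinates `bipartiteCoord`. -/
def bipartiteRes (i : ℕ) : ℕ :=
  if i < 3 then i + 1 else if i = 3 then 6 else 2 * i + 1

theorem bipartiteRes_cases (i : ℕ) : (i < 3 ∧ bipartiteRes i = i + 1) ∨
    (i = 3 ∧ bipartiteRes i = 6) ∨ (4 ≤ i ∧ bipartiteRes i = 2 * i + 1) := by
  unfold bipartiteRes; split_ifs <;> omega

theorem bipartiteCoord_res (i : ℕ) : (i = 0 ∧ bipartiteCoord (bipartiteRes i) = 6) ∨
    (i = 1 ∧ bipartiteCoord (bipartiteRes i) = 9) ∨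
    (2 ≤ i ∧ bipartiteCoord (bipartiteRes i) = 10) := by
  have := bipartiteRes_cases i
  have := bipartiteCoord_cases (bipartiteRes i)
  omega

theorem isKunz_bipartiteCoord {k : ℕ} (hk : 4 ≤ k) : IsKunz (2 * k + 1) bipartiteCoord := by
  have key : ∀ a b, a ≤ 2 → bipartiteCoord (a + b) ≤ bipartiteCoord a + bipartiteCoord b ∧
      (2 * k + 1 ≤ a + b → b < 2 * k + 1 →
        bipartiteCoord (a + b - (2 * k + 1)) ≤ bipartiteCoord a + bipartiteCoord b + 1) := by
    intro a b ha
    have h1 := bipartiteCoord_cases b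
    have h2 := bipartiteCoord_cases (a + b)
    refine ⟨?_, fun h3 h4 => ?_⟩
    · obtain rfl | rfl | rfl : a = 0 ∨ a = 1 ∨ a = 2 := by omega
      all_goals simp only [bipartiteCoord_zero, bipartiteCoord_one, bipartiteCoord_two]; omega
    · have : a + b - (2 * k + 1) = 0 ∨ a = 2 ∧ a + b - (2 * k + 1) = 1 := by omega
      rcases this with h | ⟨rfl, h⟩
      · rw [h, bipartiteCoord_zero]; omega
      · rw [h, bipartiteCoord_one, bipartiteCoord_two]; omega
  constructor
  · omega
  · rfl
  · intro i hi him
    have := bipartiteCoord_bounds i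
    omega
  · intro a b ha hb hab
    rcases Nat.lt_or_ge a 3 with h | h
    · exact (key a b (by omega)).1
    rcases Nat.lt_or_ge b 3 with h' | h'
    · rw [add_comm a, add_comm (bipartiteCoord a)]; exact (key b a (by omega)).1
    have := bipartiteCoord_bounds a
    have := bipartiteCoord_bounds b
    have := bipartiteCoord_bounds (a + b)
    omega
  · intro a b ha hb hab
    rcases Nat.lt_or_ge a 3 with h | h
    · exact (key a b (by omega)).2 hab hb
    rcases Nat.lt_or_ge b 3 with h' | h'
    · rw [add_comm a, add_comm (bipartiteCoord a)]; exact (key b a (by omega)).2 (by omega) ha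
    have := bipartiteCoord_bounds a
    have := bipartiteCoord_bounds b
    have := bipartiteCoord_bounds (a + b - (2 * k + 1))
    omega

theorem exists_splits_bipartite {k l : ℕ} (hk : 4 ≤ k) (hl0 : 0 < l) (hl : l < 2 * k + 1)
    (hne : ∀ i < k, bipartiteRes i ≠ l) :
    ∃ a b, 0 < a ∧ a < 2 * k + 1 ∧ 0 < b ∧ b < 2 * k + 1 ∧
      Splits (2 * k + 1) bipartiteCoord l a b := by
  have h0 : 1 ≠ l := hne 0 (by omega)
  have h1 : 2 ≠ l := hne 1 (by omega)
  have h2 : 3 ≠ l := hne 2 (by omega)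
  have h3 : 6 ≠ l := hne 3 (by omega)
  have h4 : 9 ≤ l → l % 2 = 0 := by
    intro h9
    by_contra hc
    have := hne (l / 2) (by omega)
    have := bipartiteRes_cases (l / 2)
    omega
  have := bipartiteCoord_cases l
  unfold Splits
  by_cases h5 : l = 5 ∨ l = 8
  · refine ⟨2, l - 2, by omega, by omega, by omega, by omega, ?_⟩
    have := bipartiteCoord_cases (l - 2)
    rw [bipartiteCoord_two]
    omega
  · refine ⟨1, l - 1, by omega, by omega, by omega, by omega, ?_⟩
    have := bipartiteCoord_cases (l - 1)
    rw [bipartiteCoord_one]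
    omega

/-- Adjacency, up to symmetry, in the graph of the semigroup with Kunz coordinates
`bipartiteCoord`. -/
def BipartiteRel (i j : ℕ) : Prop := (i = 0 ∧ 2 ≤ j) ∨ (i = 1 ∧ (j = 2 ∨ j = 3))

theorem bipartiteCoord_nonadj {k i j : ℕ} (hi : i < k) (hj : j < k)
    (hij : ¬ (BipartiteRel i j ∨ BipartiteRel j i)) (hne : ¬ (i = 0 ∧ j = 0)) :
    (bipartiteRes i + bipartiteRes j < 2 * k + 1 ∧
      bipartiteCoord (bipartiteRes i + bipartiteRes j) <
        bipartiteCoord (bipartiteRes i) + bipartiteCoord (bipartiteRes j)) ∨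
    (2 * k + 1 ≤ bipartiteRes i + bipartiteRes j ∧
      bipartiteCoord (bipartiteRes i + bipartiteRes j - (2 * k + 1)) <
        bipartiteCoord (bipartiteRes i) + bipartiteCoord (bipartiteRes j) + 1) := by
  have h1 := bipartiteCoord_res i
  have h2 := bipartiteCoord_res j
  by_cases h : 2 ≤ i ∧ 2 ≤ j
  · have := bipartiteCoord_bounds (bipartiteRes i + bipartiteRes j)
    have := bipartiteCoord_bounds (bipartiteRes i + bipartiteRes j - (2 * k + 1))
    omega
  unfold BipartiteRel at hij
  have h3 := bipartiteRes_cases i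
  have h4 := bipartiteRes_cases j
  by_cases hlt : bipartiteRes i + bipartiteRes j < 2 * k + 1
  · left
    have := bipartiteCoord_cases (bipartiteRes i + bipartiteRes j)
    refine ⟨hlt, ?_⟩
    rcases h1 with h1 | h1 | h1 <;> rcases h2 with h2 | h2 | h2 <;> omega
  · right
    have : bipartiteRes i + bipartiteRes j - (2 * k + 1) = 0 := by omega
    rw [this, bipartiteCoord_zero]
    omega

theorem splits_bipartite_edge {k i j : ℕ} (hj : j < k) (hij : BipartiteRel i j) :
    bipartiteRes i + bipartiteRes j < 2 * k + 1 ∧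
    Splits (2 * k + 1) bipartiteCoord (bipartiteRes i + bipartiteRes j) (bipartiteRes i)
      (bipartiteRes j) ∧
    ∀ c < k, ∀ b < 2 * k + 1, Splits (2 * k + 1) bipartiteCoord
      (bipartiteRes i + bipartiteRes j) (bipartiteRes c) b → c = i ∨ c = j := by
  have h1 := bipartiteCoord_res i
  have h2 := bipartiteCoord_res j
  have h3 := bipartiteRes_cases i
  have h4 := bipartiteRes_cases j
  have h5 := bipartiteCoord_cases (bipartiteRes i + bipartiteRes j)
  have h6 : bipartiteCoord (bipartiteRes i + bipartiteRes j) =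
      bipartiteCoord (bipartiteRes i) + bipartiteCoord (bipartiteRes j) := by
    unfold BipartiteRel at hij
    rcases hij with ⟨rfl, hj⟩ | ⟨rfl, rfl | rfl⟩ <;> omega
  refine ⟨by unfold BipartiteRel at hij; omega, Or.inl ⟨rfl, h6.ge⟩, fun c hc b hb h => ?_⟩
  have h7 := bipartiteCoord_res c
  have h8 := bipartiteRes_cases c
  have h9 := bipartiteCoord_cases b
  have h10 := bipartiteCoord_bounds b
  unfold BipartiteRel at hij
  unfold Splits at h
  rw [h6] at h
  rcases hij with ⟨rfl, hj⟩ | ⟨rfl, rfl | rfl⟩ <;> rcases h7 with h7 | h7 | h7 <;> omega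

/-- The graph is bipartite, with parts the residues `{1, 2}` and `{3, 6, 9, 11, ...}`. A graph
with as many edges as vertices has a cycle, which has length at least `4` as there are no
triangles, whence `4 ≤ k`. -/
theorem exists_bipartite {k : ℕ} (hk : 4 ≤ k) :
    ∃ S : AddSubmonoid ℕ, IsNumericalSemigroup S ∧ embDim S = k + 1 ∧
      mult S = 2 * k + 1 ∧ eta S = (((k + 1).choose 2 - k : ℕ) : ℕ∞) := by
  classical
  have h := isKunz_bipartiteCoord hk
  let G : SimpleGraph (Fin k) :=
    { Adj := fun i j => BipartiteRel i j ∨ BipartiteRel j i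
      symm := ⟨fun _ _ h => h.symm⟩
      loopless := ⟨fun i h => by unfold BipartiteRel at h; omega⟩ }
  have hG : ∀ i j, G.Adj i j ↔ BipartiteRel i j ∨ BipartiteRel j i := fun _ _ => Iff.rfl
  obtain ⟨ε, p, hA⟩ := h.exists_isApery (res := fun i : Fin k => bipartiteRes i)
    (y := ⟨0, by omega⟩) (t := 2) (G := G)
    (by
      intro i j hij
      have := bipartiteRes_cases i
      have := bipartiteRes_cases j
      apply Fin.ext
      simp only at hij
      omega)
    (by intro i; have := bipartiteRes_cases i; omega)
    (by intro i; have := bipartiteRes_cases i; omega)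
    rfl
    (by
      intro i a b ha0 ha hb0 hb hs
      have := bipartiteCoord_res i
      have := bipartiteCoord_bounds a
      have := bipartiteCoord_bounds b
      unfold Splits at hs
      omega)
    (fun l hl0 hl hne => exists_splits_bipartite hk hl0 hl fun i hi => hne ⟨i, hi⟩)
    (by
      intro i j l hij hjl hil
      rw [hG] at *
      unfold BipartiteRel at *
      omega)
    (by
      intro i j hij hne
      refine bipartiteCoord_nonadj i.2 j.2 hij ?_
      rintro ⟨h1, h2⟩
      exact hne (Sym2.eq_iff.2 (Or.inl ⟨Fin.ext h1, Fin.ext h2⟩)))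
    le_rfl (by omega)
    (by rw [bipartiteCoord_one, bipartiteCoord_two]; norm_num)
    (by
      intro i j hij
      rcases hij with hij | hij
      · obtain ⟨h1, h2, h3⟩ := splits_bipartite_edge j.2 hij
        exact ⟨_, h1, h2, fun c b hb hs => by simpa [Fin.ext_iff] using h3 c c.2 b hb hs⟩
      · obtain ⟨h1, h2, h3⟩ := splits_bipartite_edge i.2 hij
        exact ⟨_, h1, h2.symm,
          fun c b hb hs => by simpa [Fin.ext_iff, or_comm] using h3 c c.2 b hb hs⟩)
    (by
      intro j hj
      have hj' : j = 0 ∨ j = 1 := by omega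
      refine ⟨by rcases hj' with rfl | rfl <;> rfl, fun c b hb h => ?_⟩
      have := bipartiteCoord_res c
      have := bipartiteRes_cases c
      have := bipartiteCoord_bounds b
      apply Fin.ext
      change c.1 = 0
      unfold Splits at h
      rcases hj' with rfl | rfl
      · rw [bipartiteCoord_zero] at h; omega
      · rw [bipartiteCoord_one] at h; omega)
    (fun _ _ => rfl)
  have hcard : G.edgeFinset.card = k := by
    let f : Fin k → Sym2 (Fin k) := fun x =>
      if hx : x.1 + 2 < k then s(⟨0, by omega⟩, ⟨x.1 + 2, hx⟩)
      else s(⟨1, by omega⟩, ⟨x.1 + 4 - k, by omega⟩)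
    have hf : ∀ i j : Fin k, BipartiteRel i j → ∃ x, f x = s(i, j) := by
      rintro i j (⟨hi, hj⟩ | ⟨hi, hj⟩)
      · refine ⟨⟨j.1 - 2, by omega⟩, ?_⟩
        simp only [f]
        rw [dif_pos (by omega)]
        simp only [Sym2.eq_iff, Fin.ext_iff]; omega
      · refine ⟨⟨j.1 + k - 4, by omega⟩, ?_⟩
        simp only [f]
        rw [dif_neg (by omega)]
        simp only [Sym2.eq_iff, Fin.ext_iff]; omega
    refine card_edgeFinset_eq f ?_ ?_
    · intro x x' hx
      apply Fin.ext
      simp only [f] at hx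
      split_ifs at hx <;> simp only [Sym2.eq_iff, Fin.ext_iff] at hx <;> omega
    · intro i j
      rw [hG]
      constructor
      · rintro (hij | hij)
        · exact hf i j hij
        · rw [Sym2.eq_swap]; exact hf j i hij
      · rintro ⟨x, hx⟩
        simp only [f] at hx
        unfold BipartiteRel
        split_ifs at hx <;> simp only [Sym2.eq_iff, Fin.ext_iff] at hx <;> omega
  exact ⟨h.semigroup, h.isNumericalSemigroup, by simpa using hA.embDim_eq, h.mult_eq,
    by simpa [hcard] using hA.eta_eq⟩

end NumSgp

/-! ### Gluings of maximal embedding dimension semigroups -/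

namespace NumSgp

/-- The gluing of `{0} ∪ [k, ∞)`, scaled by `m + 1`, with the semigroup of multiples of `m`. -/
def gluedSemigroup (m k : ℕ) : AddSubmonoid ℕ where
  carrier := {n | ∃ l v, (v = 0 ∨ k ≤ v) ∧ n = l * m + (m + 1) * v}
  zero_mem' := ⟨0, 0, Or.inl rfl, by simp⟩
  add_mem' := by
    rintro _ _ ⟨l, v, hv, rfl⟩ ⟨l', v', hv', rfl⟩
    exact ⟨l + l', v + v', by omega, by ring⟩

/-- The two parts of an element of the gluing can be read off modulo `m + 1`. -/
theorem eq_of_glued_eq {m l v j a : ℕ} (hj : j ≤ m) (ha : a < m)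
    (h : l * m + (m + 1) * v = j * m + (m + 1) * a) : l = j ∧ v = a := by
  have h1 : l ≡ j [MOD (m + 1)] := by
    have : l * m + (m + 1) * v + (l + j) = j * m + (m + 1) * a + (l + j) := by rw [h]
    have e : j + (m + 1) * (l + v) = l + (m + 1) * (j + a) := by linarith
    have := congrArg (· % (m + 1)) e
    simp only [Nat.add_mul_mod_self_left] at this
    exact this.symm
  have h2 : j ≤ l := by
    by_contra! hlt
    have := h1
    rw [Nat.ModEq, Nat.mod_eq_of_lt (by omega), Nat.mod_eq_of_lt (by omega)] at this
    omega
  obtain ⟨q, hq⟩ := (Nat.modEq_iff_dvd' h2).1 h1.symm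
  obtain rfl : l = j + (m + 1) * q := by omega
  have h3 : (m + 1) * (q * m + v) = (m + 1) * a := by linarith
  have h4 := Nat.eq_of_mul_eq_mul_left (by omega) h3
  have h5 : q = 0 := by
    by_contra h0
    have := Nat.one_le_iff_ne_zero.2 h0
    nlinarith
  subst h5
  exact ⟨by simp, by simpa using h4⟩

theorem le_of_mem_glued {m k n : ℕ} (hn : n ∈ gluedSemigroup m k) (h0 : n ≠ 0) :
    m ≤ n := by
  obtain ⟨l, v, hv, rfl⟩ := hn
  rcases Nat.eq_zero_or_pos l with rfl | hl
  · have : v ≠ 0 := by rintro rfl; simp at h0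
    have := Nat.one_le_iff_ne_zero.2 this
    nlinarith
  · nlinarith

theorem self_mem_glued (m k : ℕ) : m ∈ gluedSemigroup m k := ⟨1, 0, Or.inl rfl, by simp⟩

theorem mul_mem_glued {m k v : ℕ} (hv : k ≤ v) : (m + 1) * v ∈ gluedSemigroup m k :=
  ⟨0, v, Or.inr hv, by simp⟩

theorem isNumericalSemigroup_glued {m k : ℕ} (hm : 0 < m) (hk : k ≤ m) :
    IsNumericalSemigroup (gluedSemigroup m k) := by
  refine (Set.finite_lt_nat ((2 * m + 2) * m)).subset fun n hn => ?_
  by_contra hlt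
  simp only [Set.mem_ofPred_eq, not_lt] at hlt
  refine hn ?_
  have hi := Nat.mod_lt n hm
  have hq : 2 * m + 2 ≤ n / m := (Nat.le_div_iff_mul_le hm).2 hlt
  -- With `v = m + n % m`, which is at least `k`, the difference `n - (m + 1) * v` is a multiple
  -- of `m`.
  obtain ⟨d, hd⟩ := Nat.exists_eq_add_of_le (show n % m + m + 1 ≤ n / m by omega)
  refine ⟨d, m + n % m, by omega, ?_⟩
  rw [← Nat.div_add_mod' n m]
  simp only [Nat.mul_add_mod', Nat.mod_mod]
  rw [hd]
  ring

theorem mult_glued {m k : ℕ} (hm : 0 < m) : mult (gluedSemigroup m k) = m :=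
  le_antisymm (Nat.sInf_le ⟨self_mem_glued m k, hm.ne'⟩)
    (le_csInf ⟨m, self_mem_glued m k, hm.ne'⟩ fun _ hn => le_of_mem_glued hn.1 hn.2)

theorem self_mem_atoms_glued {m k : ℕ} (hm : 0 < m) :
    m ∈ atoms (gluedSemigroup m k) := by
  refine ⟨self_mem_glued m k, hm.ne', fun a ha b hb hab => ?_⟩
  by_contra! hc
  have := le_of_mem_glued ha hc.1
  have := le_of_mem_glued hb hc.2
  omega

theorem mul_mem_atoms_glued {m k i : ℕ} (hm : 2 * k ≤ m) (hi : k ≤ i)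
    (hi' : i < 2 * k) : (m + 1) * i ∈ atoms (gluedSemigroup m k) := by
  refine ⟨mul_mem_glued hi, Nat.mul_ne_zero (by omega) (by omega), ?_⟩
  rintro _ ⟨l, v, hv, rfl⟩ _ ⟨l', v', hv', rfl⟩ h
  obtain ⟨h1, h2⟩ := eq_of_glued_eq (m := m) (l := l + l') (v := v + v') (j := 0) (a := i)
    (by omega) (by omega) (by rw [Nat.zero_mul, Nat.zero_add, ← h]; ring)
  have hl : l = 0 := by omega
  have hl' : l' = 0 := by omega
  have : v = 0 ∨ v' = 0 := by omega
  rcases this with rfl | rfl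
  · left; simp [hl]
  · right; simp [hl']

theorem eq_of_mem_atoms_glued {m k n : ℕ} (hm : 0 < m) (hk : 0 < k)
    (hn : n ∈ atoms (gluedSemigroup m k)) :
    n = m ∨ ∃ i, k ≤ i ∧ i < 2 * k ∧ n = (m + 1) * i := by
  obtain ⟨⟨l, v, hv, rfl⟩, h0, hirr⟩ := hn
  rcases Nat.eq_zero_or_pos l with rfl | hl
  · right
    have hv0 : v ≠ 0 := by rintro rfl; simp at h0
    refine ⟨v, by omega, ?_, by simp⟩
    by_contra! hlt
    obtain ⟨d, rfl⟩ := Nat.exists_eq_add_of_le (show k ≤ v by omega)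
    rcases hirr _ (mul_mem_glued le_rfl) ((m + 1) * d) (mul_mem_glued (by omega)) (by ring)
      with h | h <;> rw [Nat.mul_eq_zero] at h <;> omega
  · left
    obtain ⟨d, rfl⟩ : ∃ d, l = d + 1 := ⟨l - 1, by omega⟩
    have h := (hirr _ (self_mem_glued m k) (d * m + (m + 1) * v) ⟨d, v, hv, rfl⟩
      (by ring)).resolve_left hm.ne'
    rw [Nat.succ_mul, Nat.add_right_comm, h, Nat.zero_add]

theorem eq_of_atom_dvd_glued {m k c n j a : ℕ} (hk : 0 < k) (hj : j ≤ m) (ha : a < m)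
    (hc : c ∈ atoms (gluedSemigroup m k)) (hn : n ∈ gluedSemigroup m k)
    (h : c + n = j * m + (m + 1) * a) :
    c = m ∨ ∃ i, k ≤ i ∧ c = (m + 1) * i ∧ (i = a ∨ i + k ≤ a) := by
  rcases eq_of_mem_atoms_glued (by omega) hk hc with rfl | ⟨i, hi, -, rfl⟩
  · exact Or.inl rfl
  · right
    obtain ⟨l, v, hv, rfl⟩ := hn
    obtain ⟨-, h2⟩ := eq_of_glued_eq (m := m) (l := l) (v := i + v) hj ha (by rw [← h]; ring)
    exact ⟨i, hi, rfl, by omega⟩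

/-- The Apéry set is taken with respect to the atom `(m + 1) * k`, not to the multiplicity `m`:
the only sums of two different atoms in it are those of `m` with another atom, and the chain
consists of the multiples `j * m` with `j ≤ m`. -/
theorem exists_glued {k m : ℕ} (hk : 2 ≤ k) (hm : 2 * k ≤ m) :
    ∃ S : AddSubmonoid ℕ, IsNumericalSemigroup S ∧ embDim S = k + 1 ∧
      mult S = m ∧ eta S = (((k + 1).choose 2 - (k - 1) : ℕ) : ℕ∞) := by
  classical
  have hk0 : 0 < k := by omega
  let G : SimpleGraph (Fin k) :=
    { Adj := fun i j => (i.1 = 0 ∧ j.1 ≠ 0) ∨ (j.1 = 0 ∧ i.1 ≠ 0)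
      symm := ⟨fun _ _ h => h.symm⟩
      loopless := ⟨fun i h => by omega⟩ }
  have hG : ∀ i j, G.Adj i j ↔ (i.1 = 0 ∧ j.1 ≠ 0) ∨ (j.1 = 0 ∧ i.1 ≠ 0) :=
    fun _ _ => Iff.rfl
  let y : Fin k := ⟨0, hk0⟩
  have hy : ∀ i : Fin k, i.1 = 0 → i = y := fun i hi => Fin.ext hi
  let ε : Fin k → atoms (gluedSemigroup m k) := fun i =>
    if hi : i.1 = 0 then ⟨m, self_mem_atoms_glued (by omega)⟩
    else ⟨(m + 1) * (k + i.1), mul_mem_atoms_glued hm (by omega) (by omega)⟩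
  have hε0 : (ε y : ℕ) = m := rfl
  have hε : ∀ i : Fin k, i.1 ≠ 0 → (ε i : ℕ) = (m + 1) * (k + i.1) := fun i hi => by
    simp only [ε, dif_neg hi]
  let p : atoms (gluedSemigroup m k) :=
    ⟨(m + 1) * k, mul_mem_atoms_glued hm le_rfl (by omega)⟩
  have hne : ∀ i, m ≠ (m + 1) * (k + i) := fun i h => by nlinarith
  have hA : IsApery ε p y (m + 1) G := by
    refine ⟨?_, ?_, ?_, by omega, ?_, ?_, ⟨(m + 1) * (m - k), mul_mem_glued (by omega), ?_⟩,
      ?_, ?_, ?_⟩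
    · intro i j hij
      have hij' : (ε i : ℕ) = ε j := congrArg Subtype.val hij
      by_cases hi : i.1 = 0 <;> by_cases hj : j.1 = 0
      · exact Fin.ext (by omega)
      · rw [hy i hi, hε0, hε j hj] at hij'; exact absurd hij' (hne _)
      · rw [hy j hj, hε0, hε i hi] at hij'; exact absurd hij'.symm (hne _)
      · rw [hε i hi, hε j hj] at hij'
        have := Nat.eq_of_mul_eq_mul_left (by omega) hij'
        exact Fin.ext (by omega)
    · intro i hi
      have hi' : (ε i : ℕ) = (m + 1) * k := congrArg Subtype.val hi
      by_cases hi0 : i.1 = 0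
      · rw [hy i hi0, hε0] at hi'; exact absurd hi' (hne 0)
      · rw [hε i hi0] at hi'
        have := Nat.eq_of_mul_eq_mul_left (by omega) hi'
        omega
    · rintro ⟨a, ha⟩
      rcases eq_of_mem_atoms_glued (by omega) hk0 ha with rfl | ⟨i, hi, hi', rfl⟩
      · exact Or.inr ⟨y, rfl⟩
      · rcases hi.eq_or_lt with rfl | hlt
        · exact Or.inl rfl
        · refine Or.inr ⟨⟨i - k, by omega⟩, Subtype.ext ?_⟩
          rw [hε _ (by simp only; omega)]
          simp only [show k + (i - k) = i by omega]
    · intro i j l hij hjl hil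
      rw [hG] at *
      omega
    · intro i j hij hne
      have h1 : i.1 ≠ 0 ∧ j.1 ≠ 0 := by
        rw [hG] at hij
        have : ¬ (i.1 = 0 ∧ j.1 = 0) := fun h => hne (by rw [hy i h.1, hy j h.2])
        omega
      refine ⟨(m + 1) * (k + i.1 + j.1), mul_mem_glued (by omega), ?_⟩
      rw [hε i h1.1, hε j h1.2]
      change _ = (m + 1) * k + _
      ring
    · change (m + 1) * m = (m + 1) * k + _
      rw [← Nat.mul_add]
      congr 1
      omega
    · intro i j hij hi hj
      rw [hG] at hij
      rcases hij with h | h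
      · exact absurd (hy i h.1) hi
      · exact absurd (hy j h.1) hj
    · rintro j hj c ⟨n, hn, h⟩
      rcases eq_of_atom_dvd_glued hk0 (j := j) (a := 0) (by omega) (by omega) c.2 hn
        (by rw [h, hε0]; ring) with hc | ⟨i, hi, -, h⟩
      · exact Subtype.ext hc
      · omega
    · rintro i hi j - hj c ⟨n, hn, h⟩
      have hi0 : i.1 ≠ 0 := by
        rw [hG] at hi
        rcases hi with h | h
        · exact h.2
        · exact absurd rfl h.2
      rcases eq_of_atom_dvd_glued hk0 (j := j) (a := k + i.1) (by omega) (by omega) c.2 hn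
        (by rw [h, hε0, hε i hi0]) with hc | ⟨i', hi', hc, h⟩
      · exact Or.inl (Subtype.ext hc)
      · refine Or.inr (Subtype.ext ?_)
        rw [hc, hε i hi0]
        congr 1
        omega
  have hcard : G.edgeFinset.card = k - 1 := by
    refine card_edgeFinset_eq (fun x => s(y, ⟨x.1 + 1, by omega⟩)) ?_ ?_
    · intro x x' hx
      simp only [Sym2.eq_iff, Fin.ext_iff, y] at hx
      apply Fin.ext
      omega
    · intro i j
      rw [hG]
      simp only [Sym2.eq_iff, Fin.ext_iff, y]
      constructor
      · rintro (⟨h1, h2⟩ | ⟨h1, h2⟩)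
        · exact ⟨⟨j.1 - 1, by omega⟩, by simp only; omega⟩
        · exact ⟨⟨i.1 - 1, by omega⟩, by simp only; omega⟩
      · rintro ⟨x, hx⟩
        omega
  exact ⟨gluedSemigroup m k, isNumericalSemigroup_glued (by omega) (by omega),
    by simpa using hA.embDim_eq, mult_glued (by omega), by simpa [hcard] using hA.eta_eq⟩

end NumSgp

/-! ### The lower bound -/

namespace NumSgp

open Finsupp

/-- The nonzero elements `n` of `S` such that `n - m` is not a nonzero element of `S`, among them
the atoms, have pairwise distinct residues modulo `m`. -/
theorem eq_of_modEq_of_apery {S : AddSubmonoid ℕ} {m u v : ℕ} (hm : m ∈ S) (hu : u ∈ S)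
    (hv : v ∈ S) (hu0 : u ≠ 0) (hv0 : v ≠ 0) (hu' : ∀ n ∈ S, u = m + n → n = 0)
    (hv' : ∀ n ∈ S, v = m + n → n = 0) (h : u % m = v % m) : u = v := by
  wlog huv : u ≤ v generalizing u v
  · exact (this hv hu hv0 hu0 hv' hu' h.symm (by omega)).symm
  obtain ⟨q, hq⟩ := (Nat.modEq_iff_dvd' huv).1 h
  rcases q with _ | q
  · omega
  · have hmem : u + q * m ∈ S := add_mem hu (by simpa using nsmul_mem hm q)
    have := hv' _ hmem (by rw [Nat.mul_succ, Nat.mul_comm] at hq; omega)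
    omega

/-- The factorizations `a + b` by two atoms other than the multiplicity `m` are isolated, and every
value of such a factorization has another one, which contains `m`, unless it is one of at most `r`
Apéry elements that are not atoms. -/
theorem le_eta {S : AddSubmonoid ℕ} {e r : ℕ} (he : 0 < e) (hS : embDim S = e)
    (hmult : mult S = e + r) : ((e.choose 2 - r : ℕ) : ℕ∞) ≤ eta S := by
  classical
  set m := e + r with hm
  have hfin : (atoms S).Finite := Set.finite_of_ncard_ne_zero (by
    change embDim S ≠ 0; omega)
  have := hfin.fintype
  have hle : ∀ n ∈ S, n ≠ 0 → m ≤ n := fun n hn h0 => hmult ▸ Nat.sInf_le ⟨hn, h0⟩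
  have hmem : m ∈ S ∧ m ≠ 0 := by
    rw [← hmult]
    refine Nat.sInf_mem (s := {n | n ∈ S ∧ n ≠ 0}) ?_
    by_contra hne
    have : mult S = 0 := by
      rw [mult, Set.not_nonempty_iff_eq_empty.1 hne, Nat.sInf_empty]
    omega
  let p : atoms S := ⟨m, hmem.1, hmem.2, fun a ha b hb hab => by
    by_contra! hc
    have := hle a ha hc.1
    have := hle b hb hc.2
    omega⟩
  have hcardA : Fintype.card (atoms S) = e := by
    rw [← hS, embDim, Set.ncard_eq_toFinset_card', Set.toFinset_card]
  let ε : {a : atoms S // a ≠ p} → atoms S := Subtype.val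
  have hcard : Fintype.card (Sym2 {a : atoms S // a ≠ p}) = e.choose 2 := by
    rw [Sym2.card, Fintype.card_subtype_compl, Fintype.card_subtype_eq, hcardA,
      Nat.sub_add_cancel he]
  let val : Sym2 {a : atoms S // a ≠ p} → ℕ := fun σ => factHom S (quad ε σ)
  have hquad : ∀ σ, quad ε σ p = 0 := by
    intro σ
    induction σ with | _ i j
    simp [ε, single_eq_of_ne i.2.symm, single_eq_of_ne j.2.symm]
  -- `T` contains one pair for each Apéry element that is a sum of two atoms.
  let V : Finset ℕ := (Finset.univ.image val).filter fun n => ¬ ∃ n' ∈ S, n = m + n'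
  have hV : ∀ n ∈ V, ∃ σ, val σ = n := fun n hn => by
    simpa using (Finset.mem_filter.1 hn).1
  choose g hg using hV
  let T := V.attach.image fun n : V => g n n.2
  have hT : ∀ σ ∈ T, ∃ h : val σ ∈ V, g (val σ) h = σ := by
    intro σ hσ
    obtain ⟨⟨n, hn⟩, -, rfl⟩ := Finset.mem_image.1 hσ
    have := hg n hn
    refine ⟨by rw [this]; exact hn, by congr⟩
  have hTcard : T.card ≤ r := by
    let F : atoms S ⊕ T → ℕ := Sum.elim (fun a => (a : ℕ)) (fun σ => val σ)
    have hF : ∀ x, F x ∈ S ∧ F x ≠ 0 ∧ ∀ n ∈ S, F x = m + n → n = 0 := by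
      rintro (a | ⟨σ, hσ⟩)
      · refine ⟨a.2.1, a.2.2.1, fun n hn h => ?_⟩
        exact (a.2.2.2 m hmem.1 n hn h.symm).resolve_left hmem.2
      · refine ⟨factHom_mem _, fun h => ?_, fun n hn h => ?_⟩
        · have h1 := eq_zero_of_factHom_eq_zero h
          induction σ with | _ i j
          simp at h1
        · exact absurd ⟨n, hn, h⟩ (Finset.mem_filter.1 (hT σ hσ).1).2
    have hne : ∀ (a : atoms S) σ, (a : ℕ) ≠ val σ := by
      intro a σ h
      have h1 := isUniqueFact_single a (quad ε σ) (by rw [factHom_single, one_mul]; exact h.symm)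
      induction σ with | _ i j
      have h2 := congrArg Finsupp.degree h1
      simp at h2
    have hinj : Function.Injective fun x => (⟨F x % m, Nat.mod_lt _ (by omega)⟩ : Fin m) := by
      intro x x' hx
      have h := eq_of_modEq_of_apery hmem.1 (hF x).1 (hF x').1 (hF x).2.1 (hF x').2.1 (hF x).2.2
        (hF x').2.2 (by simpa using hx)
      rcases x with a | σ <;> rcases x' with a' | σ'
      · exact congrArg _ (Subtype.ext h)
      · exact absurd h (hne _ _)
      · exact absurd h.symm (hne _ _)
      · refine congrArg _ (Subtype.ext ?_)
        obtain ⟨h1, h2⟩ := hT σ σ.2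
        obtain ⟨h3, h4⟩ := hT σ' σ'.2
        have h5 : val σ = val σ' := h
        rw [← h2, ← h4]
        congr 1
    have := Fintype.card_le_of_injective _ hinj
    rw [Fintype.card_sum, hcardA, Fintype.card_coe, Fintype.card_fin] at this
    omega
  refine le_iInf₂ fun ρ hρ => ?_
  have hlb := card_le_encard_add_card (quad ε) (quad_injective Subtype.val_injective)
    (isIsolated_quad ε) T ?_ hρ.1
  · rw [hcard] at hlb
    rw [ENat.natCast_sub, tsub_le_iff_right]
    exact hlb.trans (by gcongr)
  intro σ
  by_cases hσ : ∃ n' ∈ S, val σ = m + n'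
  · obtain ⟨n', hn', h⟩ := hσ
    obtain ⟨u, rfl⟩ := exists_factHom_eq hn'
    refine ⟨single p 1 + u, ?_, Or.inl fun τ hτ => ?_⟩
    · rw [map_add, factHom_single, one_mul]; exact h.symm
    · have := hquad τ
      rw [← hτ] at this
      simp at this
  · have hv : val σ ∈ V := Finset.mem_filter.2 ⟨Finset.mem_image_of_mem _ (Finset.mem_univ _), hσ⟩
    exact ⟨_, hg _ hv, Or.inr 
      ⟨_, Finset.mem_image_of_mem _ (Finset.mem_attach _ ⟨_, hv⟩), rfl⟩⟩

end NumSgp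

theorem theoremt (e r : ℕ) (he : 4 ≤ e) :
    (∀ s : ℕ, s ≤ min (e - 2) r →
      ∃ S : AddSubmonoid ℕ, NumSgp.IsNumericalSemigroup S ∧
        NumSgp.embDim S = e ∧ NumSgp.mult S = e + r ∧
        NumSgp.eta S = ((e.choose 2 - s : ℕ) : ℕ∞)) ∧
    (r ≤ e - 1 → ¬ (e = 4 ∧ r = 3) →
      IsLeast {n : ℕ∞ | ∃ S : AddSubmonoid ℕ, NumSgp.IsNumericalSemigroup S ∧
        NumSgp.embDim S = e ∧ NumSgp.mult S = e + r ∧ NumSgp.eta S = n}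
        ((e.choose 2 - r : ℕ) : ℕ∞)) := by
  obtain ⟨k, rfl⟩ : ∃ k, e = k + 1 := ⟨e - 1, by omega⟩
  have h1 : ∀ s : ℕ, s ≤ min (k + 1 - 2) r →
      ∃ S : AddSubmonoid ℕ, NumSgp.IsNumericalSemigroup S ∧
        NumSgp.embDim S = k + 1 ∧ NumSgp.mult S = k + 1 + r ∧
        NumSgp.eta S = (((k + 1).choose 2 - s : ℕ) : ℕ∞) := by
    intro s hs
    rw [le_min_iff] at hs
    by_cases hsk : s = k - 1
    · subst hsk
      exact NumSgp.exists_glued (by omega) (by omega)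
    · obtain ⟨S, hS, he, hm, hη⟩ := NumSgp.exists_star (k := k) (s := s) (t := r - s + 2)
        (by omega) (by omega)
      exact ⟨S, hS, he, by omega, hη⟩
  refine ⟨h1, fun hr hne => ⟨?_, ?_⟩⟩
  · by_cases hrk : r = k
    · subst hrk
      obtain ⟨S, hS, he, hm, hη⟩ := NumSgp.exists_bipartite (k := r) (by omega)
      exact ⟨S, hS, he, by omega, hη⟩
    · exact h1 r (by omega)
  · rintro _ ⟨S, -, hS, hm, rfl⟩
    exact NumSgp.le_eta (by omega) hS hm
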